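/- Let $M$ be a smooth manifold of dimension $2m$ with a smooth pseudo-Riemannian metric $g$ of arbitrary signature, and let $D\subset T_{\mathbb C}M=\mathbb C\otimes TM$ be a maximal isotropic distribution, i.e. a smooth complex subbundle of rank $m$ on which the complex-bilinear extension of $g$ vanishes. Suppose that $D$ is integrable, $[D,D]\subset D$. (1) Suppose that $M$, $g$ and $D$ are real-analytic. Let $X$ be a complexification of $M$, that is, a complex manifold in which $M$ is real-analytically embedded so that $\mathbb C\otimes T_pM\to T_pX$ is an isomorphism for every $p\in M$, and such that every connected component of $X$ meets $M$. Let $g_{\mathbb C}$ be a holomorphic metric on $X$ (a nondegenerate symmetric holomorphic $2$-tensor) extending $g$, and let $D_{\mathbb C}\subset TX$ be a holomorphic distribution of rank $m$ extending $D$. Then every (immersed) integral surface $f:N\to X$ of $D_{\mathbb C}$ is totally geodesic: every holomorphic geodesic $\gamma$ of $g_{\mathbb C}$ with complex affine parameter that is tangent to $N$ at one point, $\gamma(0)=f(q)$ and $\gamma'(0)\in df(T_qN)$, remains in $N$ near that point, i.e. $\gamma=f\circ c$ near $0$ for a holomorphic curve germ $c$ in $N$ with $c(0)=q$. (2) Suppose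 that $g$ has Lorentzian signature. Then $D\cap\overline D$ is a complex line bundle, spanned locally by a nowhere vanishing smooth real null vector field, and the null congruence it defines is geodesic: every regular $C^2$ curve $\gamma$ in $M$ with $\gamma'\in D\cap\overline D$ is a geodesic up to parametrisation, $\nabla_{\gamma'}\gamma'=a\,\gamma'$ for some function $a$, where $\nabla$ is the Levi-Civita connection of $g$. -/

import Mathlib

open scoped Manifold ContDiff Topology TensorProduct

noncomputable section

namespace IsotropicFoliation

/-! ### Pseudo-Riemannian metrics over `ℝ` and holomorphic metrics over `ℂ` -/

section Metric

variable {𝕜 : Type*} [RCLike 𝕜] {E : Type*} [NormedAddCommGroup E] [NormedSpace 𝕜 E]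
  {M : Type*} [TopologicalSpace M] [ChartedSpace E M]

/-- The coefficients of a covariant `2`-tensor field `g` in the preferred chart at `p`: the pullback
of `g` by the inverse of that chart. -/
def inChart (g : ∀ x : M, TangentSpace 𝓘(𝕜, E) x →L[𝕜] TangentSpace 𝓘(𝕜, E) x →L[𝕜] 𝕜)
    (p : M) (y : E) : E →L[𝕜] E →L[𝕜] 𝕜 :=
  let φ := extChartAt 𝓘(𝕜, E) p
  let A : E →L[𝕜] E := mfderiv 𝓘(𝕜, E) 𝓘(𝕜, E) φ.symm y
  let G : E →L[𝕜] E →L[𝕜] 𝕜 := g (φ.symm y)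
  G.bilinearComp A A

/-- `g` is a nondegenerate symmetric `2`-tensor field of class `C^n` over `𝕜`. For `𝕜 = ℝ` this is a
pseudo-Riemannian metric of arbitrary signature (real-analytic if `n = ω`); for `𝕜 = ℂ` and `n = ω`
it is a holomorphic metric. -/
structure IsMetric (n : WithTop ℕ∞)
    (g : ∀ x : M, TangentSpace 𝓘(𝕜, E) x →L[𝕜] TangentSpace 𝓘(𝕜, E) x →L[𝕜] 𝕜) : Prop where
  symm : ∀ x u v, g x u v = g x v u
  nondegenerate : ∀ x u, (∀ v, g x u v = 0) → u = 0
  contDiffOn : ∀ p : M, ContDiffOn 𝕜 n (inChart g p) (extChartAt 𝓘(𝕜, E) p).target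

/-- The Christoffel symbols of the first kind of the Levi-Civita connection of a metric `G` on (an
open part of) `E`, that is `G (∇_u v, w)` for constant vector fields `u`, `v`, `w`. -/
def christoffel (G : E → E →L[𝕜] E →L[𝕜] 𝕜) (y u v w : E) : 𝕜 :=
  2⁻¹ * (fderiv 𝕜 G y u v w + fderiv 𝕜 G y v u w - fderiv 𝕜 G y w u v)

/-- `g (∇_{c'} c', w)` at parameter `t`, where `c` is the expression of the curve `γ` in the
preferred chart at `p` and `∇` is the Levi-Civita connection of `g`. As `g` is nondegenerate, these
numbers determine the covariant acceleration `∇_{c'} c'`. -/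
def acceleration (g : ∀ x : M, TangentSpace 𝓘(𝕜, E) x →L[𝕜] TangentSpace 𝓘(𝕜, E) x →L[𝕜] 𝕜)
    (p : M) (γ : 𝕜 → M) (t : 𝕜) (w : E) : 𝕜 :=
  let c : 𝕜 → E := fun s => extChartAt 𝓘(𝕜, E) p (γ s)
  inChart g p (c t) (deriv (deriv c) t) w
    + christoffel (inChart g p) (c t) (deriv c t) (deriv c t) w

/-- Near the parameter `t₀` the curve `γ` is an (affinely parametrised) geodesic: `∇_{γ'} γ' = 0`.
For `𝕜 = ℂ` the parameter is complex and `γ` is holomorphic. -/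
def IsGeodesicAt (g : ∀ x : M, TangentSpace 𝓘(𝕜, E) x →L[𝕜] TangentSpace 𝓘(𝕜, E) x →L[𝕜] 𝕜)
    (γ : 𝕜 → M) (t₀ : 𝕜) : Prop :=
  ContMDiffAt 𝓘(𝕜, 𝕜) 𝓘(𝕜, E) 2 γ t₀ ∧
    ∀ᶠ t in 𝓝 t₀, ∀ w : E, acceleration g (γ t₀) γ t w = 0

/-- Near the parameter `t₀` the curve `γ` is a geodesic up to parametrisation: `γ' ≠ 0` and
`∇_{γ'} γ'` is proportional to `γ'`. -/
def IsUnparametrizedGeodesicAt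
    (g : ∀ x : M, TangentSpace 𝓘(𝕜, E) x →L[𝕜] TangentSpace 𝓘(𝕜, E) x →L[𝕜] 𝕜)
    (γ : 𝕜 → M) (t₀ : 𝕜) : Prop :=
  ContMDiffAt 𝓘(𝕜, 𝕜) 𝓘(𝕜, E) 2 γ t₀ ∧
    mfderiv 𝓘(𝕜, 𝕜) 𝓘(𝕜, E) γ t₀ ≠ 0 ∧
    ∀ᶠ t in 𝓝 t₀, ∃ a : 𝕜, ∀ w : E, acceleration g (γ t₀) γ t w =
      a * inChart g (γ t₀) (extChartAt 𝓘(𝕜, E) (γ t₀) (γ t))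
        (deriv (fun s => extChartAt 𝓘(𝕜, E) (γ t₀) (γ s)) t) w

variable {E' : Type*} [NormedAddCommGroup E'] [NormedSpace 𝕜 E']
  {N : Type*} [TopologicalSpace N] [ChartedSpace E' N]

/-- The immersed submanifold `f : N → M` is totally geodesic: every geodesic of `M` that is tangent
to it at one parameter value stays in it for nearby parameter values. -/
def IsTotallyGeodesic
    (g : ∀ x : M, TangentSpace 𝓘(𝕜, E) x →L[𝕜] TangentSpace 𝓘(𝕜, E) x →L[𝕜] 𝕜)
    (f : N → M) : Prop :=
  ∀ (γ : 𝕜 → M) (q : N) (u : TangentSpace 𝓘(𝕜, E') q), IsGeodesicAt g γ 0 →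
    tangentMap 𝓘(𝕜, 𝕜) 𝓘(𝕜, E) γ ⟨0, (1 : 𝕜)⟩ = tangentMap 𝓘(𝕜, E') 𝓘(𝕜, E) f ⟨q, u⟩ →
    ∃ c : 𝕜 → N, c 0 = q ∧ ContMDiffAt 𝓘(𝕜, 𝕜) 𝓘(𝕜, E') 2 c 0 ∧ ∀ᶠ t in 𝓝 0, f (c t) = γ t

/-- The map `f : N → M` is an (immersed) integral manifold of the distribution `D` on `M`. -/
structure IsIntegralManifold (D : ∀ x : M, Submodule 𝕜 (TangentSpace 𝓘(𝕜, E) x))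
    (f : N → M) : Prop where
  contMDiff : ContMDiff 𝓘(𝕜, E') 𝓘(𝕜, E) ω f
  injective : ∀ q, Function.Injective (mfderiv 𝓘(𝕜, E') 𝓘(𝕜, E) f q)
  range_eq : ∀ q, (mfderiv 𝓘(𝕜, E') 𝓘(𝕜, E) f q).range = D (f q)

/-- `D` is a subbundle of rank `m` and class `C^n` of the tangent bundle of `M`. -/
def IsDistribution [IsManifold 𝓘(𝕜, E) 1 M] (n : WithTop ℕ∞) (m : ℕ)
    (D : ∀ x : M, Submodule 𝕜 (TangentSpace 𝓘(𝕜, E) x)) : Prop :=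
  ∀ p : M, ∃ (U : Set M) (V : Fin m → ∀ x : M, TangentSpace 𝓘(𝕜, E) x), IsOpen U ∧ p ∈ U ∧
    (∀ i, ContMDiffOn 𝓘(𝕜, E) 𝓘(𝕜, E).tangent n
      (fun x => (⟨x, V i x⟩ : TangentBundle 𝓘(𝕜, E) M)) U) ∧
    ∀ x ∈ U, LinearIndependent 𝕜 (fun i => V i x) ∧
      D x = Submodule.span 𝕜 (Set.range fun i => V i x)

end Metric

/-! ### The complexified tangent bundle of a real manifold -/

section Linear

variable {V : Type*} [AddCommGroup V] [Module ℝ V]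

/-- The complex vector `a + i b`. -/
def complexVector (a b : V) : ℂ ⊗[ℝ] V := (1 : ℂ) ⊗ₜ[ℝ] a + Complex.I ⊗ₜ[ℝ] b

/-- Complex conjugation on the complexification of a real vector space. -/
def conjugation (V : Type*) [AddCommGroup V] [Module ℝ V] : ℂ ⊗[ℝ] V →ₗ[ℝ] ℂ ⊗[ℝ] V :=
  LinearMap.rTensor V Complex.conjAe.toLinearMap

theorem conjugation_smul (c : ℂ) (z : ℂ ⊗[ℝ] V) :
    conjugation V (c • z) = (starRingEnd ℂ) c • conjugation V z := by
  induction z using TensorProduct.induction_on with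
  | zero => simp
  | tmul a v => simp [conjugation, TensorProduct.smul_tmul']
  | add x y hx hy => simp only [smul_add, map_add, hx, hy]

/-- The complex conjugate of a complex subspace of the complexification. -/
def conjugate (D : Submodule ℂ (ℂ ⊗[ℝ] V)) : Submodule ℂ (ℂ ⊗[ℝ] V) where
  carrier := {z | conjugation V z ∈ D}
  zero_mem' := by simp
  add_mem' := by
    intro x y hx hy
    simpa using D.add_mem hx hy
  smul_mem' := by
    intro c x hx
    simpa [conjugation_smul] using D.smul_mem _ hx

/-- The complex-bilinear extension of a real bilinear form vanishes on `D`. -/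
def IsIsotropic (b : LinearMap.BilinForm ℝ V) (D : Submodule ℂ (ℂ ⊗[ℝ] V)) : Prop :=
  ∀ v ∈ D, ∀ w ∈ D, b.baseChange ℂ v w = 0

/-- `b` has Lorentzian signature `(1, n - 1)` or `(n - 1, 1)`. -/
def IsLorentzian (b : LinearMap.BilinForm ℝ V) : Prop :=
  let Q : QuadraticForm ℝ V := LinearMap.BilinMap.toQuadraticMap b
  (sigPos Q = 1 ∧ sigNeg Q + 1 = Module.finrank ℝ V) ∨
    (sigNeg Q = 1 ∧ sigPos Q + 1 = Module.finrank ℝ V)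

end Linear

section RealManifold

variable {E : Type*} [NormedAddCommGroup E] [NormedSpace ℝ E]
  {M : Type*} [TopologicalSpace M] [ChartedSpace E M]

/-- The value at `x` of a real metric, as a bilinear form. -/
def bilin (g : ∀ x : M, TangentSpace 𝓘(ℝ, E) x →L[ℝ] TangentSpace 𝓘(ℝ, E) x →L[ℝ] ℝ) (x : M) :
    LinearMap.BilinForm ℝ (TangentSpace 𝓘(ℝ, E) x) :=
  LinearMap.mk₂ ℝ (fun u v => g x u v) (by simp) (by simp) (by simp) (by simp)

/-- `D` is a subbundle of complex rank `m` and class `C^n` of the complexified tangent bundle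
`ℂ ⊗ TM`: near every point it has a frame `A i + √-1 B i` with `A i`, `B i` real vector fields of
class `C^n`. -/
def IsComplexDistribution [IsManifold 𝓘(ℝ, E) 1 M] (n : WithTop ℕ∞) (m : ℕ)
    (D : ∀ x : M, Submodule ℂ (ℂ ⊗[ℝ] TangentSpace 𝓘(ℝ, E) x)) : Prop :=
  ∀ p : M, ∃ (U : Set M) (A B : Fin m → ∀ x : M, TangentSpace 𝓘(ℝ, E) x), IsOpen U ∧ p ∈ U ∧
    (∀ i, ContMDiffOn 𝓘(ℝ, E) 𝓘(ℝ, E).tangent n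
      (fun x => (⟨x, A i x⟩ : TangentBundle 𝓘(ℝ, E) M)) U) ∧
    (∀ i, ContMDiffOn 𝓘(ℝ, E) 𝓘(ℝ, E).tangent n
      (fun x => (⟨x, B i x⟩ : TangentBundle 𝓘(ℝ, E) M)) U) ∧
    ∀ x ∈ U, LinearIndependent ℂ (fun i => complexVector (A i x) (B i x)) ∧
      D x = Submodule.span ℂ (Set.range fun i => complexVector (A i x) (B i x))

/-- The Frobenius condition `[D, D] ⊆ D` for local smooth sections `A₁ + i B₁`, `A₂ + i B₂` of a
distribution in the complexified tangent bundle, with the complex-bilinear Lie bracket. -/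
def IsIntegrable [IsManifold 𝓘(ℝ, E) 1 M]
    (D : ∀ x : M, Submodule ℂ (ℂ ⊗[ℝ] TangentSpace 𝓘(ℝ, E) x)) : Prop :=
  ∀ (U : Set M) (A₁ B₁ A₂ B₂ : ∀ x : M, TangentSpace 𝓘(ℝ, E) x), IsOpen U →
    (∀ V ∈ [A₁, B₁, A₂, B₂], ContMDiffOn 𝓘(ℝ, E) 𝓘(ℝ, E).tangent ∞
      (fun x => (⟨x, V x⟩ : TangentBundle 𝓘(ℝ, E) M)) U) →
    (∀ x ∈ U, complexVector (A₁ x) (B₁ x) ∈ D x ∧ complexVector (A₂ x) (B₂ x) ∈ D x) →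
    ∀ x ∈ U, complexVector
      (VectorField.mlieBracket 𝓘(ℝ, E) A₁ A₂ x - VectorField.mlieBracket 𝓘(ℝ, E) B₁ B₂ x)
      (VectorField.mlieBracket 𝓘(ℝ, E) A₁ B₂ x + VectorField.mlieBracket 𝓘(ℝ, E) B₁ A₂ x) ∈ D x

/-! ### Complexification of a real-analytic manifold -/

variable {F : Type*} [NormedAddCommGroup F] [NormedSpace ℂ F]
  {X : Type*} [TopologicalSpace X] [ChartedSpace F X]

/-- The complex-linear extension `ℂ ⊗ T_p M → T_{ι p} X` of the real differential of a map `ι` from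
a real manifold to a complex manifold. -/
def complexDifferential (ι : M → X) (p : M) :
    ℂ ⊗[ℝ] TangentSpace 𝓘(ℝ, E) p →ₗ[ℂ] TangentSpace 𝓘(ℂ, F) (ι p) :=
  let A : TangentSpace 𝓘(ℝ, E) p →L[ℝ] F := mfderiv 𝓘(ℝ, E) 𝓘(ℝ, F) ι p
  let B : ℂ ⊗[ℝ] TangentSpace 𝓘(ℝ, E) p →ₗ[ℂ] F := LinearMap.liftBaseChange ℂ A.toLinearMap
  B

/-- `ι : M → X` exhibits the complex manifold `X` as a complexification of the real-analytic manifold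
`M`: a real-analytic embedding onto a maximally totally real submanifold of `X`. As usual `X` is only
a neighbourhood of `M`, so that all its components meet `M`. -/
structure IsComplexification (ι : M → X) : Prop where
  isEmbedding : Topology.IsEmbedding ι
  analytic : ContMDiff 𝓘(ℝ, E) 𝓘(ℝ, F) ω ι
  bijective : ∀ p, Function.Bijective (complexDifferential (E := E) (F := F) ι p)
  meets : ∀ x, ∃ p, ι p ∈ connectedComponent x

/-- The complex-bilinear tensor field `gc` on `X` restricts to the real tensor field `g` on `M`. -/
def ExtendsMetric (ι : M → X)
    (g : ∀ x : M, TangentSpace 𝓘(ℝ, E) x →L[ℝ] TangentSpace 𝓘(ℝ, E) x →L[ℝ] ℝ)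
    (gc : ∀ x : X, TangentSpace 𝓘(ℂ, F) x →L[ℂ] TangentSpace 𝓘(ℂ, F) x →L[ℂ] ℂ) : Prop :=
  ∀ p, ∀ u v : TangentSpace 𝓘(ℝ, E) p,
    gc (ι p) (complexDifferential ι p ((1 : ℂ) ⊗ₜ[ℝ] u)) (complexDifferential ι p ((1 : ℂ) ⊗ₜ[ℝ] v))
      = (g p u v : ℂ)

/-- The distribution `Dc` on `X` restricts to `D` on `M`. -/
def ExtendsDistribution (ι : M → X)
    (D : ∀ x : M, Submodule ℂ (ℂ ⊗[ℝ] TangentSpace 𝓘(ℝ, E) x))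
    (Dc : ∀ x : X, Submodule ℂ (TangentSpace 𝓘(ℂ, F) x)) : Prop :=
  ∀ p, Dc (ι p) = (D p).map (complexDifferential ι p)

end RealManifold

end IsotropicFoliation

end

/-!
Differentiating `g(∂ᵢψ, ∂ⱼψ) = 0` and permuting indices shows that along an isotropic immersion `ψ`
of half the dimension the covariant derivatives of tangent fields are orthogonal to the tangent
spaces, hence tangent again, these being their own orthogonal complements. A geodesic `x` that is
tangent to `ψ` at one point is written `x = ψ(c) + k` with `k` in a fixed complement of the tangent
space. The complement pairs nondegenerately with the tangent spaces, so the tangential components of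
the geodesic equation bound `k''` linearly by `k` and `k'`, and Grönwall's inequality gives `k = 0`.
In a complexification the distribution is isotropic on `M`, hence near `M`, because a holomorphic
function vanishing on a maximally totally real submanifold has zero Taylor series there, and then
everywhere, by the identity theorem.

In Lorentzian signature the real points of `D` form an isotropic subspace, so their dimension is at
most one. It is not zero, since otherwise every `a` is the real part of some `a + i b` in `D`, with
`g(a, a) = g(b, b)` and `g(a, b) = 0`, so that timelike directions come in orthogonal pairs. The
line is the orthogonal complement of the real and imaginary parts of `D`, which yields a smooth
section `k`. For `w` among these parts, `D` being isotropic, `g(∇ₖ k, w) = -g(k, ∇ₖ w)` equals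
`-g(k, [k, w])`, which vanishes by integrability. Hence `∇ₖ k` is a multiple of `k`.
-/

noncomputable section

namespace IsotropicFoliation

set_option maxSynthPendingDepth 3

section AccelerationForm

variable {𝕜 : Type*} [RCLike 𝕜] {E : Type*} [NormedAddCommGroup E] [NormedSpace 𝕜 E]
  {V : Type*} [NormedAddCommGroup V] [NormedSpace 𝕜 V]
  {G : E → E →L[𝕜] E →L[𝕜] 𝕜}

/-- The linear form `G (∇_{c'} c', ·)` on `E`, for a curve `c` through `z` with velocity `v` and
second derivative `a`. -/
def accelerationForm (G : E → E →L[𝕜] E →L[𝕜] 𝕜) (z v a : E) : E →L[𝕜] 𝕜 :=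
  G z a + (2⁻¹ : 𝕜) •
    (fderiv 𝕜 G z v v + fderiv 𝕜 G z v v - ((fderiv 𝕜 G z).flip v).flip v)

theorem accelerationForm_apply (z v a w : E) :
    accelerationForm G z v a w = G z a w + christoffel G z v v w := by
  simp [accelerationForm, christoffel]

theorem accelerationForm_add_right (z v a b : E) :
    accelerationForm G z v (a + b) = accelerationForm G z v a + G z b := by
  simp only [accelerationForm, map_add]
  abel

theorem accelerationForm_smul (z v a : E) (r : 𝕜) :
    accelerationForm G z (r • v) (r ^ 2 • a) = r ^ 2 • accelerationForm G z v a := by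
  ext w
  simp only [accelerationForm_apply, christoffel, map_smul, smul_apply, smul_eq_mul]
  ring

theorem contDiffAt_accelerationForm {n : WithTop ℕ∞} {z v a : V → E} {p : V}
    (hG : ContDiffAt 𝕜 (n + 1) G (z p)) (hz : ContDiffAt 𝕜 n z p) (hv : ContDiffAt 𝕜 n v p)
    (ha : ContDiffAt 𝕜 n a p) :
    ContDiffAt 𝕜 n (fun q => accelerationForm G (z q) (v q) (a q)) p := by
  have hGz : ContDiffAt 𝕜 n (fun q => G (z q)) p := (hG.of_le le_self_add).comp p hz
  have hG' : ContDiffAt 𝕜 n (fun q => fderiv 𝕜 G (z q)) p := (hG.fderiv_right le_rfl).comp p hz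
  have hflip : ContDiffAt 𝕜 n (fun q => (fderiv 𝕜 G (z q)).flip (v q)) p :=
    ((ContinuousLinearMap.flipₗᵢ 𝕜 E E (E →L[𝕜] 𝕜)).contDiff.contDiffAt.comp p hG').clm_apply hv
  have hflip' : ContDiffAt 𝕜 n (fun q => ((fderiv 𝕜 G (z q)).flip (v q)).flip (v q)) p :=
    ((ContinuousLinearMap.flipₗᵢ 𝕜 E E 𝕜).contDiff.contDiffAt.comp p hflip).clm_apply hv
  have hdiag := (hG'.clm_apply hv).clm_apply hv
  exact (hGz.clm_apply ha).add (((hdiag.add hdiag).sub hflip').const_smul _)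

theorem fderiv_apply_apply_of_eventually_eq_zero {B : V → E →L[𝕜] E →L[𝕜] 𝕜} {u v : V → E} {y : V}
    {B' : V →L[𝕜] E →L[𝕜] E →L[𝕜] 𝕜} {u' v' : V →L[𝕜] E} (hB : HasFDerivAt B B' y)
    (hu : HasFDerivAt u u' y) (hv : HasFDerivAt v v' y)
    (h : ∀ᶠ z in 𝓝 y, B z (u z) (v z) = 0) (d : V) :
    B' d (u y) (v y) + B y (u' d) (v y) + B y (u y) (v' d) = 0 := by
  have hconst : HasFDerivAt (fun z => B z (u z) (v z)) (0 : V →L[𝕜] 𝕜) y :=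
    (hasFDerivAt_const (0 : 𝕜) y).congr_of_eventuallyEq h
  have := DFunLike.congr_fun (((hB.clm_apply hu).clm_apply hv).unique hconst) d
  simp only [ContinuousLinearMap.comp_apply, ContinuousLinearMap.flip_apply, add_apply,
    zero_apply] at this
  rw [← this]
  ring

/-- The Koszul formula along the map `x`: with `K = x_* u` and `W = x_* w` at `y`, torsion-freeness
turns `∇_u W - ∇_w K` into `W' u - K' w`. -/
theorem accelerationForm_apply_of_null {x K W : V → E} {x' K' W' : V →L[𝕜] E} {y u w : V}
    (hG : DifferentiableAt 𝕜 G (x y)) (hsymm : ∀ a b, G (x y) a b = G (x y) b a)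
    (hx : HasFDerivAt x x' y) (hK : HasFDerivAt K K' y) (hW : HasFDerivAt W W' y)
    (hu : x' u = K y) (hw : x' w = W y) (hKK : ∀ᶠ z in 𝓝 y, G (x z) (K z) (K z) = 0)
    (hKW : ∀ᶠ z in 𝓝 y, G (x z) (K z) (W z) = 0) :
    accelerationForm G (x y) (K y) (K' u) (W y) = G (x y) (K y) (K' w - W' u) := by
  have hGx : HasFDerivAt (fun z => G (x z)) (fderiv 𝕜 G (x y) ∘L x') y :=
    HasFDerivAt.comp (g := G) y hG.hasFDerivAt hx
  have hww := fderiv_apply_apply_of_eventually_eq_zero hGx hK hK hKK w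
  have huw := fderiv_apply_apply_of_eventually_eq_zero hGx hK hW hKW u
  rw [hsymm (K' w)] at hww
  simp only [ContinuousLinearMap.comp_apply, hu, hw] at hww huw
  rw [accelerationForm_apply, christoffel, map_sub]
  linear_combination huw - 2⁻¹ * hww

theorem accelerationForm_eq_zero_of_isotropic {ψ : V → E} {y : V} (hψ : ContDiffAt 𝕜 2 ψ y)
    (hG : DifferentiableAt 𝕜 G (ψ y)) (hsymm : ∀ a b, G (ψ y) a b = G (ψ y) b a)
    (hiso : ∀ᶠ z in 𝓝 y, ∀ a b, G (ψ z) (fderiv 𝕜 ψ z a) (fderiv 𝕜 ψ z b) = 0) (u b w : V) :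
    accelerationForm G (ψ y) (fderiv 𝕜 ψ y u)
      (fderiv 𝕜 (fderiv 𝕜 ψ) y u u + fderiv 𝕜 ψ y b) (fderiv 𝕜 ψ y w) = 0 := by
  have hψ' : HasFDerivAt (fderiv 𝕜 ψ) (fderiv 𝕜 (fderiv 𝕜 ψ) y) y :=
    ((hψ.fderiv_right (m := 1) le_rfl).differentiableAt one_ne_zero).hasFDerivAt
  have hfield (a : V) := hψ'.clm_apply (hasFDerivAt_const a y)
  have hnull := accelerationForm_apply_of_null (u := u) (w := w) hG hsymm
    (hψ.differentiableAt two_ne_zero).hasFDerivAt (hfield u) (hfield w) rfl rfl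
    (hiso.mono fun z hz => hz u u) (hiso.mono fun z hz => hz u w)
  have hcomm : fderiv 𝕜 (fderiv 𝕜 ψ) y w u = fderiv 𝕜 (fderiv 𝕜 ψ) y u w :=
    hψ.isSymmSndFDerivAt (by simp) w u
  simp only [ContinuousLinearMap.comp_zero, zero_add, ContinuousLinearMap.flip_apply, hcomm,
    sub_self, map_zero] at hnull
  rw [accelerationForm_add_right, add_apply, hiso.self_of_nhds b w, add_zero, hnull]

open VectorField in
theorem accelerationForm_apply_eq_neg_lieBracket {k w : E → E} {y : E}
    (hG : DifferentiableAt 𝕜 G y) (hsymm : ∀ a b, G y a b = G y b a)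
    (hk : DifferentiableAt 𝕜 k y) (hw : DifferentiableAt 𝕜 w y)
    (hkk : ∀ᶠ z in 𝓝 y, G z (k z) (k z) = 0) (hkw : ∀ᶠ z in 𝓝 y, G z (k z) (w z) = 0) :
    accelerationForm G y (k y) (fderiv 𝕜 k y (k y)) (w y) =
      -G y (k y) (lieBracket 𝕜 k w y) := by
  have hnull := accelerationForm_apply_of_null (x := fun z => z) (u := k y) (w := w y) hG hsymm
    (hasFDerivAt_id y) hk.hasFDerivAt hw.hasFDerivAt rfl rfl hkk hkw
  rw [hnull, lieBracket_eq, ← map_neg, neg_sub]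

end AccelerationForm

section Curves

variable {𝕜 : Type*} [RCLike 𝕜] {E : Type*} [NormedAddCommGroup E] [NormedSpace 𝕜 E]
  {E' : Type*} [NormedAddCommGroup E'] [NormedSpace 𝕜 E']

theorem differentiableAt_deriv {c : 𝕜 → E} {t : 𝕜} (hc : ContDiffAt 𝕜 2 c t) :
    DifferentiableAt 𝕜 (deriv c) t :=
  (hc.derivWithin (m := 1) le_rfl).differentiableAt one_ne_zero

theorem eventually_deriv_eq_smul {k : E → E} {c : 𝕜 → E} {t : 𝕜} (hc : ContDiffAt 𝕜 2 c t)
    (hk : DifferentiableAt 𝕜 k (c t)) (hk0 : k (c t) ≠ 0)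
    (hck : ∀ᶠ s in 𝓝 t, deriv c s ∈ Submodule.span 𝕜 {k (c s)}) :
    ∃ f : 𝕜 → 𝕜, DifferentiableAt 𝕜 f t ∧ ∀ᶠ s in 𝓝 t, deriv c s = f s • k (c s) := by
  obtain ⟨τ, hτ⟩ := SeparatingDual.exists_eq_one (R := 𝕜) hk0
  have hτk : DifferentiableAt 𝕜 (fun s => τ (k (c s))) t :=
    τ.differentiableAt.comp t <|
      DifferentiableAt.comp (g := k) t hk (hc.differentiableAt two_ne_zero)
  have hτ0 : τ (k (c t)) ≠ 0 := hτ ▸ one_ne_zero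
  refine ⟨fun s => τ (deriv c s) / τ (k (c s)),
    (τ.differentiableAt.comp t (differentiableAt_deriv hc)).div hτk hτ0, ?_⟩
  filter_upwards [hck, hτk.continuousAt.eventually_ne hτ0] with s hs hτs
  obtain ⟨r, hr⟩ := Submodule.mem_span_singleton.1 hs
  rw [← hr, map_smul, smul_eq_mul, mul_div_cancel_right₀ r hτs]

theorem exists_accelerationForm_eq_smul_of_deriv_mem_span {G : E → E →L[𝕜] E →L[𝕜] 𝕜} {k : E → E}
    {c : 𝕜 → E} {t r : 𝕜} (hc : ContDiffAt 𝕜 2 c t) (hc0 : deriv c t ≠ 0)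
    (hk : DifferentiableAt 𝕜 k (c t)) (hk0 : k (c t) ≠ 0)
    (hck : ∀ᶠ s in 𝓝 t, deriv c s ∈ Submodule.span 𝕜 {k (c s)})
    (hpre : accelerationForm G (c t) (k (c t)) (fderiv 𝕜 k (c t) (k (c t))) =
      r • G (c t) (k (c t))) :
    ∃ a : 𝕜, accelerationForm G (c t) (deriv c t) (deriv (deriv c) t) =
      a • G (c t) (deriv c t) := by
  obtain ⟨f, hf, hcf⟩ := eventually_deriv_eq_smul hc hk hk0 hck
  have hct := hcf.self_of_nhds
  have hf0 : f t ≠ 0 := fun h => hc0 (by rw [hct, h, zero_smul])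
  have hkc : HasDerivAt (fun s => k (c s)) (f t • fderiv 𝕜 k (c t) (k (c t))) t := by
    rw [← map_smul, ← hct]
    exact hk.hasFDerivAt.comp_hasDerivAt t (hc.differentiableAt two_ne_zero).hasDerivAt
  have hcc : deriv (deriv c) t =
      f t ^ 2 • fderiv 𝕜 k (c t) (k (c t)) + deriv f t • k (c t) := by
    rw [((hf.hasDerivAt.smul hkc).congr_of_eventuallyEq hcf).deriv, smul_smul, sq]
  refine ⟨(f t ^ 2 * r + deriv f t) / f t, ?_⟩
  rw [hcc, hct, accelerationForm_add_right, accelerationForm_smul, hpre, map_smul, map_smul,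
    smul_smul, smul_smul, ← add_smul, div_mul_cancel₀ _ hf0]

end Curves

section Uniqueness

variable {𝕜 : Type*} [RCLike 𝕜] {E : Type*} [NormedAddCommGroup E] [NormedSpace 𝕜 E]

open Asymptotics

theorem eventually_eq_zero_of_deriv_isBigO {u : 𝕜 → E} {t₀ : 𝕜}
    (hu : ∀ᶠ t in 𝓝 t₀, DifferentiableAt 𝕜 u t) (h0 : u t₀ = 0) (hu' : deriv u =O[𝓝 t₀] u) :
    ∀ᶠ t in 𝓝 t₀, u t = 0 := by
  let _ : NormedSpace ℝ E := NormedSpace.restrictScalars ℝ 𝕜 E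
  obtain ⟨C, hC⟩ := hu'.bound
  obtain ⟨r, hr, hball⟩ := Metric.eventually_nhds_iff_ball.1 (hu.and hC)
  filter_upwards [Metric.ball_mem_nhds t₀ hr] with t ht
  let segment (s : ℝ) : 𝕜 := t₀ + (s : 𝕜) * (t - t₀)
  have hmem : ∀ s ∈ Set.Icc (0 : ℝ) 1, segment s ∈ Metric.ball t₀ r := by
    intro s hs
    rw [mem_ball_iff_norm] at ht ⊢
    calc ‖segment s - t₀‖ = s * ‖t - t₀‖ := by
          simp [segment, abs_of_nonneg hs.1]
      _ ≤ 1 * ‖t - t₀‖ := by gcongr; exact hs.2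
      _ < r := by rwa [one_mul]
  have hsegment (s : ℝ) : HasDerivAt segment (t - t₀) s := by
    simpa [segment] using (RCLike.ofRealCLM (K := 𝕜)).hasDerivAt.mul_const (t - t₀)
  have hderiv : ∀ s ∈ Set.Icc (0 : ℝ) 1,
      HasDerivAt (fun s => u (segment s)) ((t - t₀) • deriv u (segment s)) s := fun s hs =>
    HasDerivAt.scomp (g₁ := u) s (hball _ (hmem s hs)).1.hasDerivAt (hsegment s)
  have hone : u (segment 1) = 0 :=
    eq_zero_of_abs_deriv_le_mul_abs_self_of_eq_zero_right (K := ‖t - t₀‖ * C)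
      (fun s hs => (hderiv s hs).continuousAt.continuousWithinAt)
      (fun s hs => (hderiv s (Set.Ico_subset_Icc_self hs)).hasDerivWithinAt)
      (by simp [segment, h0])
      (fun s hs => by
        rw [norm_smul, mul_assoc]
        gcongr
        exact (hball _ (hmem s (Set.Ico_subset_Icc_self hs))).2)
      1 (Set.right_mem_Icc.2 zero_le_one)
  simpa [segment] using hone

theorem eventually_eq_zero_of_deriv_deriv_isBigO {k : 𝕜 → E} {t₀ : 𝕜} (hk : ContDiffAt 𝕜 2 k t₀)
    (h0 : k t₀ = 0) (h1 : deriv k t₀ = 0)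
    (h2 : deriv (deriv k) =O[𝓝 t₀] fun t => (k t, deriv k t)) : ∀ᶠ t in 𝓝 t₀, k t = 0 := by
  have hderiv : ∀ᶠ t in 𝓝 t₀, HasDerivAt (fun t => (k t, deriv k t))
      (deriv k t, deriv (deriv k) t) t :=
    (hk.eventually (by simp)).mono fun t ht =>
      (ht.differentiableAt two_ne_zero).hasDerivAt.prodMk (differentiableAt_deriv ht).hasDerivAt
  have hzero := eventually_eq_zero_of_deriv_isBigO (hderiv.mono fun t ht => ht.differentiableAt)
    (Prod.ext h0 h1) <|
      ((isBigO_of_le _ fun t => le_max_right _ _).prod_left h2).congr'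
        (hderiv.mono fun t ht => ht.deriv.symm) .rfl
  exact hzero.mono fun t ht => (Prod.mk.inj ht).1

theorem isBigO_apply_of_injective {α K W : Type*} [NormedAddCommGroup K] [NormedSpace 𝕜 K]
    [FiniteDimensional 𝕜 K] [NormedAddCommGroup W] [NormedSpace 𝕜 W] {l : Filter α}
    {T : α → K →L[𝕜] W} {T₀ : K →L[𝕜] W} (hT : Filter.Tendsto T l (𝓝 T₀))
    (hinj : Function.Injective T₀) (κ : α → K) : κ =O[l] fun a => T a (κ a) := by
  obtain ⟨c, -, hc⟩ := (T₀ : K →ₗ[𝕜] W).exists_antilipschitzWith (LinearMap.ker_eq_bot.2 hinj)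
  have hκ : κ =O[l] fun a => T₀ (κ a) :=
    .of_bound c (.of_forall fun a => by simpa using hc.le_mul_dist (κ a) 0)
  have hsmall : (fun a => (T a - T₀) (κ a)) =o[l] fun a => T₀ (κ a) := by
    refine IsLittleO.trans_isBigO (g := κ) ?_ hκ
    have hT0 : (fun a => T a - T₀) =o[l] fun _ => (1 : ℝ) :=
      (isLittleO_one_iff ℝ).2 (tendsto_sub_nhds_zero_iff.2 hT)
    have hmul : (fun a => ‖T a - T₀‖ * ‖κ a‖) =o[l] κ := by
      simpa using hT0.norm_left.mul_isBigO (isBigO_refl κ l).norm_norm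
    exact (isBigO_of_le l fun a => by
      simpa using (T a - T₀).le_opNorm (κ a)).trans_isLittleO hmul
  exact (hκ.trans hsmall.right_isBigO_add).congr_right fun a => by simp

end Uniqueness

section Orthogonal

variable {K V : Type*} [Field K] [AddCommGroup V] [Module K V] [FiniteDimensional K V]
  {B : LinearMap.BilinForm K V}

theorem orthogonal_eq_of_finrank_add (hB : B.Nondegenerate) {R S : Submodule K V}
    (hS : S ≤ B.orthogonal R)
    (hdim : Module.finrank K R + Module.finrank K S = Module.finrank K V) :
    B.orthogonal R = S := by
  refine (Submodule.eq_of_le_of_finrank_eq hS ?_).symm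
  rw [LinearMap.BilinForm.finrank_orthogonal hB]
  omega

theorem orthogonal_eq_self_of_isotropic (hB : B.Nondegenerate) {R : Submodule K V}
    (hR : ∀ v ∈ R, ∀ w ∈ R, B v w = 0) (hdim : Module.finrank K V = 2 * Module.finrank K R) :
    B.orthogonal R = R :=
  orthogonal_eq_of_finrank_add hB (fun w hw v hv => hR v hv w hw) (by omega)

end Orthogonal

section Transverse

variable {𝕜 : Type*} [RCLike 𝕜] {E : Type*} [NormedAddCommGroup E] [NormedSpace 𝕜 E]
  {E' : Type*} [NormedAddCommGroup E'] [NormedSpace 𝕜 E']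
  {ψ : E' → E} {G : E → E →L[𝕜] E →L[𝕜] 𝕜} {K : Submodule 𝕜 E}
  {x : 𝕜 → E} {c : 𝕜 → E'} {k : 𝕜 → K} {t₀ : 𝕜}

open Asymptotics

theorem exists_straightening [FiniteDimensional 𝕜 E] [FiniteDimensional 𝕜 E'] {n : WithTop ℕ∞}
    (hn : n ≠ 0) {y : E'} (hψ : ContDiffAt 𝕜 n ψ y)
    (hinj : Function.Injective (fderiv 𝕜 ψ y)) (hK : IsCompl (fderiv 𝕜 ψ y).range K) :
    ∃ s : E → E' × K, ContDiffAt 𝕜 n s (ψ y) ∧ s (ψ y) = (y, 0) ∧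
      ∀ᶠ z in 𝓝 (ψ y), ψ (s z).1 + (s z).2 = z := by
  have : CompleteSpace (E' × K) := FiniteDimensional.complete 𝕜 _
  let Φ : E' × K → E := fun p => ψ p.1 + p.2
  let e : (E' × K) ≃L[𝕜] E := (((LinearEquiv.ofInjective (fderiv 𝕜 ψ y : E' →ₗ[𝕜] E) hinj).prodCongr
    (.refl 𝕜 K)).trans (Submodule.prodEquivOfIsCompl _ K hK)).toContinuousLinearEquiv
  have hΦ : ContDiffAt 𝕜 n Φ (y, 0) :=
    (ContDiffAt.comp (y, (0 : K)) (g := ψ) hψ contDiffAt_fst).add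
      (K.subtypeL.contDiff.contDiffAt.comp _ contDiffAt_snd)
  have hΦ' : HasFDerivAt Φ (e : (E' × K) →L[𝕜] E) (y, 0) :=
    HasFDerivAt.add (f' := fderiv 𝕜 ψ y ∘L .fst 𝕜 E' K)
      (HasFDerivAt.comp (y, (0 : K)) (g := ψ) (hψ.differentiableAt hn).hasFDerivAt hasFDerivAt_fst)
      (K.subtypeL.hasFDerivAt.comp (y, (0 : K)) hasFDerivAt_snd)
  have hΦy : Φ (y, 0) = ψ y := by simp [Φ]
  rw [← hΦy]
  exact ⟨hΦ.localInverse hΦ' hn, hΦ.to_localInverse hΦ' hn, hΦ.localInverse_apply_image hΦ' hn,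
    (hΦ.hasStrictFDerivAt' hΦ' hn).eventually_right_inverse⟩

theorem eventually_deriv_eq_add (hψ : ContDiffAt 𝕜 2 ψ (c t₀)) (hc : ContDiffAt 𝕜 2 c t₀)
    (hk : ContDiffAt 𝕜 2 k t₀) (hx : ∀ᶠ t in 𝓝 t₀, ψ (c t) + k t = x t) :
    ∀ᶠ t in 𝓝 t₀, deriv x t = fderiv 𝕜 ψ (c t) (deriv c t) + deriv k t := by
  filter_upwards [hx.eventually_nhds, hc.continuousAt.eventually (hψ.eventually (by simp)),
    hc.eventually (by simp), hk.eventually (by simp)] with t hxt hψt hct hkt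
  have hψc := (hψt.differentiableAt two_ne_zero).hasFDerivAt.comp_hasDerivAt t
    (hct.differentiableAt two_ne_zero).hasDerivAt
  have hkE := K.subtypeL.hasFDerivAt.comp_hasDerivAt t
    (hkt.differentiableAt two_ne_zero).hasDerivAt
  exact ((hψc.add hkE).congr_of_eventuallyEq (Filter.EventuallyEq.symm hxt)).deriv

theorem eventually_deriv_deriv_eq_add (hψ : ContDiffAt 𝕜 2 ψ (c t₀)) (hc : ContDiffAt 𝕜 2 c t₀)
    (hk : ContDiffAt 𝕜 2 k t₀) (hx : ∀ᶠ t in 𝓝 t₀, ψ (c t) + k t = x t) :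
    ∀ᶠ t in 𝓝 t₀, deriv (deriv x) t =
      fderiv 𝕜 (fderiv 𝕜 ψ) (c t) (deriv c t) (deriv c t) + fderiv 𝕜 ψ (c t) (deriv (deriv c) t) +
        deriv (deriv k) t := by
  filter_upwards [(eventually_deriv_eq_add hψ hc hk hx).eventually_nhds,
    hc.continuousAt.eventually (hψ.eventually (by simp)),
    hc.eventually (by simp), hk.eventually (by simp)] with t hxt hψt hct hkt
  have hψ' := ((hψt.fderiv_right (m := 1) le_rfl).differentiableAt one_ne_zero).hasFDerivAt
  have hψc := (hψ'.comp_hasDerivAt t (hct.differentiableAt two_ne_zero).hasDerivAt).clm_apply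
    (differentiableAt_deriv hct).hasDerivAt
  have hkE := K.subtypeL.hasFDerivAt.comp_hasDerivAt t (differentiableAt_deriv hkt).hasDerivAt
  exact ((hψc.add hkE).congr_of_eventuallyEq hxt).deriv

theorem isBigO_comp_sub_of_comp_eq_zero {α V W : Type*} [NormedAddCommGroup V] [NormedSpace 𝕜 V]
    [NormedAddCommGroup W] [NormedSpace 𝕜 W] {l : Filter α} {f : V → W} {p : V} {P Q : α → V}
    (hf : ContDiffAt 𝕜 1 f p) (hP : Filter.Tendsto P l (𝓝 p)) (hQ : Filter.Tendsto Q l (𝓝 p))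
    (hfQ : ∀ᶠ a in l, f (Q a) = 0) : (fun a => f (P a)) =O[l] fun a => P a - Q a := by
  refine ((hf.hasStrictFDerivAt one_ne_zero).isBigO_sub.comp_tendsto
    (hP.prodMk_nhds hQ)).congr' ?_ .rfl
  filter_upwards [hfQ] with a ha
  simp [ha]

theorem accelerationForm_comp_isBigO {α : Type*} {l : Filter α} {z v a ζ η : α → E}
    {P : α → E' →L[𝕜] E} {z₀ v₀ a₀ : E} {P₀ : E' →L[𝕜] E} (hG : ContDiffAt 𝕜 2 G z₀)
    (hz : Filter.Tendsto z l (𝓝 z₀)) (hv : Filter.Tendsto v l (𝓝 v₀))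
    (ha : Filter.Tendsto a l (𝓝 a₀)) (hP : Filter.Tendsto P l (𝓝 P₀))
    (hζ : Filter.Tendsto ζ l (𝓝 0)) (hη : Filter.Tendsto η l (𝓝 0))
    (hzero : ∀ᶠ i in l, accelerationForm G (z i) (v i) (a i) ∘L P i = 0) :
    (fun i => accelerationForm G (z i + ζ i) (v i + η i) (a i) ∘L P i) =O[l]
      fun i => (ζ i, η i) := by
  let force (q : E × E × E × (E' →L[𝕜] E)) : E' →L[𝕜] 𝕜 :=
    accelerationForm G q.1 q.2.1 q.2.2.1 ∘L q.2.2.2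
  have hforce : ContDiffAt 𝕜 1 force (z₀, v₀, a₀, P₀) :=
    (contDiffAt_accelerationForm (n := 1) hG contDiffAt_fst (by fun_prop) (by fun_prop)).clm_comp
      (by fun_prop)
  have hbase := hz.prodMk_nhds (hv.prodMk_nhds (ha.prodMk_nhds hP))
  have hdisplaced : Filter.Tendsto (fun i => (z i + ζ i, v i + η i, a i, P i)) l
      (𝓝 (z₀, v₀, a₀, P₀)) := by
    simpa only [add_zero] using
      (hz.add hζ).prodMk_nhds ((hv.add hη).prodMk_nhds (ha.prodMk_nhds hP))
  refine (isBigO_comp_sub_of_comp_eq_zero hforce hdisplaced hbase hzero).trans ?_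
  exact isBigO_of_le l fun i => by simp [Prod.norm_def]

/-- The error of the geodesic equation in the directions tangent to `ψ` is of first order in the
transverse displacement `k`, because by isotropy it vanishes for the curve `ψ ∘ c`. -/
theorem tangential_accelerationForm_isBigO (hψ : ContDiffAt 𝕜 2 ψ (c t₀))
    (hG : ContDiffAt 𝕜 2 G (ψ (c t₀))) (hsymm : ∀ z u v, G z u v = G z v u)
    (hiso : ∀ᶠ z in 𝓝 (c t₀), ∀ v w, G (ψ z) (fderiv 𝕜 ψ z v) (fderiv 𝕜 ψ z w) = 0)
    (hc : ContDiffAt 𝕜 2 c t₀) (hk : ContDiffAt 𝕜 2 k t₀) (hk0 : k t₀ = 0)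
    (hk1 : deriv k t₀ = 0) :
    (fun t => accelerationForm G (ψ (c t) + k t)
      (fderiv 𝕜 ψ (c t) (deriv c t) + ((deriv k t : K) : E))
      (fderiv 𝕜 (fderiv 𝕜 ψ) (c t) (deriv c t) (deriv c t) +
        fderiv 𝕜 ψ (c t) (deriv (deriv c) t)) ∘L fderiv 𝕜 ψ (c t)) =O[𝓝 t₀]
      fun t => (k t, deriv k t) := by
  have hψ' : ContDiffAt 𝕜 1 (fderiv 𝕜 ψ) (c t₀) := hψ.fderiv_right le_rfl
  have hc' : ContDiffAt 𝕜 1 (deriv c) t₀ := hc.derivWithin le_rfl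
  have hψ'c : ContinuousAt (fun t => fderiv 𝕜 ψ (c t)) t₀ :=
    ContinuousAt.comp (g := fderiv 𝕜 ψ) hψ'.continuousAt hc.continuousAt
  have hψ''c : ContinuousAt (fun t => fderiv 𝕜 (fderiv 𝕜 ψ) (c t)) t₀ :=
    ContinuousAt.comp (g := fderiv 𝕜 (fderiv 𝕜 ψ))
      (hψ'.fderiv_right (m := 0) le_rfl).continuousAt hc.continuousAt
  have hc'' : ContinuousAt (deriv (deriv c)) t₀ := (hc'.derivWithin (m := 0) le_rfl).continuousAt
  have hkE : Filter.Tendsto (fun t => (k t : E)) (𝓝 t₀) (𝓝 0) := by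
    simpa [hk0, Function.comp_def] using
      (continuous_subtype_val.continuousAt.comp hk.continuousAt).tendsto
  have hk'E : Filter.Tendsto (fun t => ((deriv k t : K) : E)) (𝓝 t₀) (𝓝 0) := by
    simpa [hk1, Function.comp_def] using (continuous_subtype_val.continuousAt.comp
      (hk.derivWithin (m := 1) le_rfl).continuousAt).tendsto
  have htangent : ∀ᶠ t in 𝓝 t₀, accelerationForm G (ψ (c t)) (fderiv 𝕜 ψ (c t) (deriv c t))
      (fderiv 𝕜 (fderiv 𝕜 ψ) (c t) (deriv c t) (deriv c t) +
        fderiv 𝕜 ψ (c t) (deriv (deriv c) t)) ∘L fderiv 𝕜 ψ (c t) = 0 := by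
    filter_upwards [hc.continuousAt.eventually (hψ.eventually (by simp)),
      hc.continuousAt.eventually hiso.eventually_nhds,
      hc.continuousAt.eventually (hψ.continuousAt.eventually (hG.eventually (by simp)))]
      with t hψt hisot hGt
    ext w
    exact accelerationForm_eq_zero_of_isotropic hψt (hGt.differentiableAt two_ne_zero)
      (hsymm _) hisot _ _ w
  have herror := accelerationForm_comp_isBigO (z := fun t => ψ (c t)) hG
    (ContinuousAt.comp (g := ψ) hψ.continuousAt hc.continuousAt) (hψ'c.clm_apply hc'.continuousAt)
    (a := fun t => fderiv 𝕜 (fderiv 𝕜 ψ) (c t) (deriv c t) (deriv c t) +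
      fderiv 𝕜 ψ (c t) (deriv (deriv c) t))
    (((hψ''c.clm_apply hc'.continuousAt).clm_apply hc'.continuousAt).add (hψ'c.clm_apply hc''))
    hψ'c hkE hk'E htangent
  exact herror.trans (isBigO_of_le _ fun t => by simp [Prod.norm_def])

theorem deriv_deriv_isBigO_of_geodesic [FiniteDimensional 𝕜 E] (hψ : ContDiffAt 𝕜 2 ψ (c t₀))
    (hG : ContDiffAt 𝕜 2 G (ψ (c t₀))) (hsymm : ∀ z u v, G z u v = G z v u)
    (hiso : ∀ᶠ z in 𝓝 (c t₀), ∀ v w, G (ψ z) (fderiv 𝕜 ψ z v) (fderiv 𝕜 ψ z w) = 0)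
    (hpairing : ∀ κ : K, (∀ w, G (ψ (c t₀)) κ (fderiv 𝕜 ψ (c t₀) w) = 0) → κ = 0)
    (hc : ContDiffAt 𝕜 2 c t₀) (hk : ContDiffAt 𝕜 2 k t₀) (hk0 : k t₀ = 0)
    (hk1 : deriv k t₀ = 0) (hx : ∀ᶠ t in 𝓝 t₀, ψ (c t) + k t = x t)
    (hgeo : ∀ᶠ t in 𝓝 t₀, accelerationForm G (x t) (deriv x t) (deriv (deriv x) t) = 0) :
    deriv (deriv k) =O[𝓝 t₀] fun t => (k t, deriv k t) := by
  let pairing (t : 𝕜) : K →L[𝕜] E' →L[𝕜] 𝕜 :=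
    (ContinuousLinearMap.compL 𝕜 E' E 𝕜).flip (fderiv 𝕜 ψ (c t)) ∘L G (ψ (c t) + k t) ∘L K.subtypeL
  have hpairing₀ : Function.Injective (pairing t₀) := by
    refine (injective_iff_map_eq_zero _).2 fun κ hκ => hpairing κ fun w => ?_
    simpa [pairing, hk0] using DFunLike.congr_fun hκ w
  have hcurve : ContinuousAt (fun t => ψ (c t) + (k t : E)) t₀ :=
    (ContinuousAt.comp (g := ψ) hψ.continuousAt hc.continuousAt).add
      (continuous_subtype_val.continuousAt.comp hk.continuousAt)
  have hψ'c : ContinuousAt (fun t => fderiv 𝕜 ψ (c t)) t₀ :=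
    ContinuousAt.comp (g := fderiv 𝕜 ψ) (hψ.fderiv_right (m := 1) le_rfl).continuousAt
      hc.continuousAt
  have hGcurve : ContinuousAt (fun t => G (ψ (c t) + (k t : E))) t₀ :=
    ContinuousAt.comp (g := G) (by simpa [hk0] using hG.continuousAt) hcurve
  have hpairing_cont : ContinuousAt pairing t₀ :=
    ((ContinuousLinearMap.compL 𝕜 E' E 𝕜).flip.continuous.continuousAt.comp hψ'c).clm_comp
      (hGcurve.clm_comp continuousAt_const)
  refine (isBigO_apply_of_injective hpairing_cont hpairing₀ (deriv (deriv k))).trans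
    ((tangential_accelerationForm_isBigO hψ hG hsymm hiso hc hk hk0 hk1).neg_left.congr' ?_ .rfl)
  filter_upwards [hgeo, hx, eventually_deriv_eq_add hψ hc hk hx,
    eventually_deriv_deriv_eq_add hψ hc hk hx] with t hgeot hxt hx't hx''t
  rw [hx''t, hx't, ← hxt, accelerationForm_add_right] at hgeot
  refine neg_eq_of_add_eq_zero_right ?_
  exact (ContinuousLinearMap.add_comp _ _ _).symm.trans <|
    (congrArg (·.comp (fderiv 𝕜 ψ (c t))) hgeot).trans (ContinuousLinearMap.zero_comp _)

theorem eq_zero_of_orthogonal_range [FiniteDimensional 𝕜 E] {b : E →L[𝕜] E →L[𝕜] 𝕜}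
    {T : E' →L[𝕜] E} (hdim : Module.finrank 𝕜 E = 2 * Module.finrank 𝕜 E')
    (hsymm : ∀ v w, b v w = b w v) (hnondeg : ∀ v, (∀ w, b v w = 0) → v = 0)
    (hT : Function.Injective T) (hiso : ∀ v w, b (T v) (T w) = 0) (hK : IsCompl T.range K) {κ : E}
    (hκK : κ ∈ K) (hκ : ∀ w, b κ (T w) = 0) : κ = 0 := by
  have hB : (b.toLinearMap₁₂ : LinearMap.BilinForm 𝕜 E).Nondegenerate :=
    ⟨hnondeg, fun w hw => hnondeg w fun v => (hsymm w v).trans (hw v)⟩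
  have hrange : LinearMap.BilinForm.orthogonal b.toLinearMap₁₂ T.range = T.range := by
    refine orthogonal_eq_self_of_isotropic hB ?_ ?_
    · rintro _ ⟨v, rfl⟩ _ ⟨w, rfl⟩
      exact hiso v w
    · rw [hdim, LinearMap.finrank_range_of_inj hT]
  refine Submodule.disjoint_def.1 hK.disjoint κ (hrange ▸ ?_) hκK
  rintro _ ⟨w, rfl⟩
  exact (hsymm _ _).trans (hκ w)

theorem exists_lift_of_geodesic [FiniteDimensional 𝕜 E] [FiniteDimensional 𝕜 E']
    (hdim : Module.finrank 𝕜 E = 2 * Module.finrank 𝕜 E') {y u : E'}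
    (hψ : ContDiffAt 𝕜 2 ψ y) (hinj : Function.Injective (fderiv 𝕜 ψ y))
    (hG : ContDiffAt 𝕜 2 G (ψ y)) (hsymm : ∀ z v w, G z v w = G z w v)
    (hnondeg : ∀ v, (∀ w, G (ψ y) v w = 0) → v = 0)
    (hiso : ∀ᶠ z in 𝓝 y, ∀ v w, G (ψ z) (fderiv 𝕜 ψ z v) (fderiv 𝕜 ψ z w) = 0)
    (hx : ContDiffAt 𝕜 2 x t₀) (hx0 : x t₀ = ψ y) (hx1 : deriv x t₀ = fderiv 𝕜 ψ y u)
    (hgeo : ∀ᶠ t in 𝓝 t₀, accelerationForm G (x t) (deriv x t) (deriv (deriv x) t) = 0) :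
    ∃ c : 𝕜 → E', ContDiffAt 𝕜 2 c t₀ ∧ c t₀ = y ∧ ∀ᶠ t in 𝓝 t₀, ψ (c t) = x t := by
  obtain ⟨K, hK⟩ := Submodule.exists_isCompl (fderiv 𝕜 ψ y).range
  obtain ⟨s, hs, hsy, hs_inv⟩ := exists_straightening two_ne_zero hψ hinj hK
  have hsx : ContDiffAt 𝕜 2 (fun t => s (x t)) t₀ :=
    ContDiffAt.comp (g := s) t₀ (hx0 ▸ hs) hx
  let c (t : 𝕜) : E' := (s (x t)).1
  let k (t : 𝕜) : K := (s (x t)).2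
  have hc : ContDiffAt 𝕜 2 c t₀ := contDiffAt_fst.comp t₀ hsx
  have hk : ContDiffAt 𝕜 2 k t₀ := contDiffAt_snd.comp t₀ hsx
  have hc0 : c t₀ = y := by simp [c, hx0, hsy]
  have hk0 : k t₀ = 0 := by simp [k, hx0, hsy]
  have hdecomp : ∀ᶠ t in 𝓝 t₀, ψ (c t) + k t = x t :=
    (hx0 ▸ hx.continuousAt.tendsto : Filter.Tendsto x (𝓝 t₀) (𝓝 (ψ y))).eventually hs_inv
  rw [← hc0] at hψ hinj hG hnondeg hiso hx1 hK
  have hk1 : deriv k t₀ = 0 := by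
    have hvelocity := (eventually_deriv_eq_add hψ hc hk hdecomp).self_of_nhds
    have hmem : ((deriv k t₀ : K) : E) ∈ (fderiv 𝕜 ψ (c t₀)).range :=
      ⟨u - deriv c t₀, by simp [← hx1, hvelocity]⟩
    exact Subtype.ext (Submodule.disjoint_def.1 hK.disjoint _ hmem (deriv k t₀).2)
  have hbound := deriv_deriv_isBigO_of_geodesic hψ hG hsymm hiso
    (fun κ hκ => Subtype.ext <| eq_zero_of_orthogonal_range hdim (hsymm _) hnondeg hinj
      hiso.self_of_nhds hK κ.2 hκ) hc hk hk0 hk1 hdecomp hgeo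
  refine ⟨c, hc, hc0, ?_⟩
  filter_upwards [eventually_eq_zero_of_deriv_deriv_isBigO hk hk0 hk1 hbound, hdecomp]
    with t hkt hxt
  simpa [hkt] using hxt

end Transverse

section Complexification

variable {V : Type*} [AddCommGroup V] [Module ℝ V]

/-- The real part of a complexified vector. -/
def rePart (V : Type*) [AddCommGroup V] [Module ℝ V] : ℂ ⊗[ℝ] V →ₗ[ℝ] V :=
  (TensorProduct.lid ℝ V).toLinearMap ∘ₗ LinearMap.rTensor V Complex.reLm

/-- The imaginary part of a complexified vector. -/
def imPart (V : Type*) [AddCommGroup V] [Module ℝ V] : ℂ ⊗[ℝ] V →ₗ[ℝ] V :=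
  (TensorProduct.lid ℝ V).toLinearMap ∘ₗ LinearMap.rTensor V Complex.imLm

theorem complexVector_rePart_imPart (z : ℂ ⊗[ℝ] V) :
    complexVector (rePart V z) (imPart V z) = z := by
  induction z using TensorProduct.induction_on with
  | zero => simp [complexVector]
  | tmul c v =>
    simp only [complexVector, rePart, imPart, LinearMap.coe_comp, Function.comp_apply,
      LinearMap.rTensor_tmul, LinearEquiv.coe_coe, TensorProduct.lid_tmul, Complex.reLm_coe,
      Complex.imLm_coe, TensorProduct.tmul_smul, ← TensorProduct.add_tmul,
      TensorProduct.smul_tmul']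
    congr 1
    simp
  | add x y hx hy =>
    conv_rhs => rw [← hx, ← hy]
    simp only [complexVector, map_add, TensorProduct.tmul_add]
    abel

theorem complexVector_zero_right (a : V) : complexVector a 0 = (1 : ℂ) ⊗ₜ[ℝ] a := by
  simp [complexVector]

theorem conjugation_complexVector (a b : V) :
    conjugation V (complexVector a b) = complexVector a (-b) := by
  simp [conjugation, complexVector, TensorProduct.neg_tmul, TensorProduct.tmul_neg]

theorem baseChange_complexVector (β : LinearMap.BilinForm ℝ V) (a b c d : V) :
    β.baseChange ℂ (complexVector a b) (complexVector c d) =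
      ⟨β a c - β b d, β a d + β b c⟩ := by
  simp only [complexVector, map_add, LinearMap.add_apply, LinearMap.BilinForm.baseChange_tmul,
    Complex.ext_iff]
  constructor <;> simp <;> ring

theorem nondegenerate_baseChange_complex {β : LinearMap.BilinForm ℝ V} (hβ : β.Nondegenerate) :
    (β.baseChange ℂ).Nondegenerate := by
  constructor
  · intro z hz
    have hz' (v : V) : β (rePart V z) v = 0 ∧ β (imPart V z) v = 0 := by
      have h := hz (complexVector v 0)
      rw [← complexVector_rePart_imPart z, baseChange_complexVector, Complex.ext_iff] at h
      simpa using h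
    rw [← complexVector_rePart_imPart z, hβ.1 _ fun v => (hz' v).1, hβ.1 _ fun v => (hz' v).2,
      complexVector_zero_right, TensorProduct.tmul_zero]
  · intro z hz
    have hz' (v : V) : β v (rePart V z) = 0 ∧ β v (imPart V z) = 0 := by
      have h := hz (complexVector v 0)
      rw [← complexVector_rePart_imPart z, baseChange_complexVector, Complex.ext_iff] at h
      simpa using h
    rw [← complexVector_rePart_imPart z, hβ.2 _ fun v => (hz' v).1, hβ.2 _ fun v => (hz' v).2,
      complexVector_zero_right, TensorProduct.tmul_zero]

theorem isIsotropic_neg {β : LinearMap.BilinForm ℝ V} {D : Submodule ℂ (ℂ ⊗[ℝ] V)}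
    (hD : IsIsotropic β D) : IsIsotropic (-β) D := by
  intro v hv w hw
  have h := hD v hv w hw
  rw [← complexVector_rePart_imPart v, ← complexVector_rePart_imPart w, baseChange_complexVector,
    Complex.ext_iff] at h ⊢
  obtain ⟨hre, him⟩ := h
  simp only [Complex.zero_re, Complex.zero_im, LinearMap.neg_apply] at hre him ⊢
  exact ⟨by linarith, by linarith⟩

/-- The real vectors that lie in a complex subspace of the complexification. -/
def realPoints (D : Submodule ℂ (ℂ ⊗[ℝ] V)) : Submodule ℝ V :=
  (D.restrictScalars ℝ).comap (TensorProduct.mk ℝ ℂ V 1)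

theorem mem_realPoints {D : Submodule ℂ (ℂ ⊗[ℝ] V)} {v : V} :
    v ∈ realPoints D ↔ (1 : ℂ) ⊗ₜ[ℝ] v ∈ D := Iff.rfl

theorem complexVector_zero_left_mem_iff {D : Submodule ℂ (ℂ ⊗[ℝ] V)} {v : V} :
    complexVector 0 v ∈ D ↔ v ∈ realPoints D := by
  have h : complexVector 0 v = Complex.I • ((1 : ℂ) ⊗ₜ[ℝ] v) := by
    simp [complexVector, TensorProduct.smul_tmul']
  rw [h, D.smul_mem_iff Complex.I_ne_zero, mem_realPoints]

theorem apply_eq_zero_of_complexVector_mem {β : LinearMap.BilinForm ℝ V}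
    {D : Submodule ℂ (ℂ ⊗[ℝ] V)} (hD : IsIsotropic β D) {k a b : V} (hk : k ∈ realPoints D)
    (hab : complexVector a b ∈ D) : β k a = 0 ∧ β k b = 0 := by
  have h := hD _ (mem_realPoints.1 hk) _ hab
  rw [← complexVector_zero_right, baseChange_complexVector, Complex.ext_iff] at h
  simpa using h

theorem apply_eq_zero_of_mem_realPoints {β : LinearMap.BilinForm ℝ V}
    {D : Submodule ℂ (ℂ ⊗[ℝ] V)} (hD : IsIsotropic β D) {v w : V} (hv : v ∈ realPoints D)
    (hw : w ∈ realPoints D) : β v w = 0 := by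
  simpa using hD _ hv _ hw

theorem inf_conjugate_eq_baseChange_realPoints (D : Submodule ℂ (ℂ ⊗[ℝ] V)) :
    D ⊓ conjugate D = (realPoints D).baseChange ℂ := by
  apply le_antisymm
  · rintro z ⟨hz, hzc⟩
    have hzc : conjugation V z ∈ D := hzc
    rw [← complexVector_rePart_imPart z] at hz hzc ⊢
    rw [conjugation_complexVector] at hzc
    have hre : rePart V z ∈ realPoints D := by
      have h := D.smul_mem (2⁻¹ : ℂ) (D.add_mem hz hzc)
      rwa [complexVector, complexVector, TensorProduct.tmul_neg, ← sub_eq_add_neg,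
        add_add_sub_cancel, ← two_smul ℂ, inv_smul_smul₀ two_ne_zero] at h
    have him : imPart V z ∈ realPoints D := by
      have h : Complex.I ⊗ₜ[ℝ] imPart V z ∈ D := (D.add_mem_iff_right hre).1 hz
      rwa [← complexVector_zero_left_mem_iff, complexVector, TensorProduct.tmul_zero, zero_add]
    exact add_mem (Submodule.tmul_mem_baseChange_of_mem _ hre)
      (Submodule.tmul_mem_baseChange_of_mem _ him)
  · rw [Submodule.baseChange_eq_span, Submodule.span_le]
    rintro _ ⟨v, hv, rfl⟩
    refine ⟨hv, ?_⟩
    change conjugation V ((1 : ℂ) ⊗ₜ[ℝ] v) ∈ D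
    rw [← complexVector_zero_right, conjugation_complexVector, neg_zero, complexVector_zero_right]
    exact hv

theorem one_tmul_mem_inf_conjugate_iff {D : Submodule ℂ (ℂ ⊗[ℝ] V)} {v : V} :
    (1 : ℂ) ⊗ₜ[ℝ] v ∈ D ⊓ conjugate D ↔ v ∈ realPoints D := by
  refine ⟨fun h => h.1, fun h => ?_⟩
  rw [inf_conjugate_eq_baseChange_realPoints]
  exact Submodule.tmul_mem_baseChange_of_mem _ h

theorem finrank_inf_conjugate (D : Submodule ℂ (ℂ ⊗[ℝ] V)) :
    Module.finrank ℂ ↥(D ⊓ conjugate D) = Module.finrank ℝ (realPoints D) := by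
  rw [inf_conjugate_eq_baseChange_realPoints,
    ← (Submodule.toBaseChange.toLinearEquiv ℂ (realPoints D)).finrank_eq,
    Module.finrank_baseChange]

section MaximalIsotropic

variable [FiniteDimensional ℝ V] {β : LinearMap.BilinForm ℝ V} {D : Submodule ℂ (ℂ ⊗[ℝ] V)}

theorem mem_realPoints_iff_of_eq_span (hβ : β.Nondegenerate) (hD : IsIsotropic β D)
    (hdim : Module.finrank ℝ V = 2 * Module.finrank ℂ D) {ι : Type*} {A B : ι → V}
    (hspan : D = Submodule.span ℂ (Set.range fun i => complexVector (A i) (B i))) {v : V} :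
    v ∈ realPoints D ↔ ∀ i, β (A i) v = 0 ∧ β (B i) v = 0 := by
  have horth := orthogonal_eq_self_of_isotropic (nondegenerate_baseChange_complex hβ) hD
    (Module.finrank_baseChange.trans hdim)
  have hframe (i : ι) : β.baseChange ℂ (complexVector (A i) (B i)) ((1 : ℂ) ⊗ₜ[ℝ] v) = 0 ↔
      β (A i) v = 0 ∧ β (B i) v = 0 := by
    rw [← complexVector_zero_right, baseChange_complexVector, Complex.ext_iff]
    simp
  rw [mem_realPoints, ← horth, LinearMap.BilinForm.mem_orthogonal_iff]
  simp_rw [← hframe]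
  refine ⟨fun h i => h _ ?_, fun h => ?_⟩
  · exact hspan ▸ Submodule.subset_span ⟨i, rfl⟩
  · have hle : D ≤ ((β.baseChange ℂ).flip ((1 : ℂ) ⊗ₜ[ℝ] v)).ker := by
      rw [hspan, Submodule.span_le]
      rintro _ ⟨i, rfl⟩
      exact h i
    exact fun z hz => hle hz

theorem exists_complexVector_mem_of_realPoints_eq_bot
    (hdim : Module.finrank ℝ V = 2 * Module.finrank ℂ D) (hbot : realPoints D = ⊥) (a : V) :
    ∃ b, complexVector a b ∈ D := by
  let re : D.restrictScalars ℝ →ₗ[ℝ] V := (rePart V).domRestrict (D.restrictScalars ℝ)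
  have hinj : Function.Injective re := by
    refine (injective_iff_map_eq_zero re).2 ?_
    rintro ⟨z, hz : z ∈ D⟩ (hre : rePart V z = 0)
    have him : imPart V z = 0 := by
      rw [← Submodule.mem_bot ℝ, ← hbot, ← complexVector_zero_left_mem_iff, ← hre,
        complexVector_rePart_imPart]
      exact hz
    have hz0 : z = 0 := by
      rw [← complexVector_rePart_imPart z, hre, him, complexVector_zero_right,
        TensorProduct.tmul_zero]
    exact Subtype.ext hz0
  have hfinrank : Module.finrank ℝ (D.restrictScalars ℝ) = Module.finrank ℝ V :=
    (finrank_real_of_complex D).trans hdim.symm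
  obtain ⟨⟨z, hz⟩, rfl⟩ :=
    (LinearMap.injective_iff_surjective_of_finrank_eq_finrank hfinrank).1 hinj a
  exact ⟨imPart V z, (complexVector_rePart_imPart z).symm ▸ hz⟩

theorem two_le_sigPos_of_orthogonal (hsymm : ∀ u v, β u v = β v u) {a b : V}
    (hab : β a b = 0) (ha : 0 < β a a) (hb : 0 < β b b) :
    2 ≤ sigPos (LinearMap.BilinMap.toQuadraticMap β : QuadraticForm ℝ V) := by
  have hba : β b a = 0 := hsymm b a ▸ hab
  have hfinrank : Module.finrank ℝ (Submodule.span ℝ {a, b}) = 2 := by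
    have hind : LinearIndependent ℝ ![a, b] := LinearIndependent.pair_iff.2 fun x y h =>
      ⟨by simpa [hab, ha.ne'] using congrArg (β a) h, by simpa [hba, hb.ne'] using congrArg (β b) h⟩
    rw [← Matrix.range_cons_cons_empty, finrank_span_eq_card hind, Fintype.card_fin]
  rw [← hfinrank]
  refine le_sigPos_of_posDef _ ?_
  rintro ⟨v, hv⟩ hv0
  obtain ⟨x, y, rfl⟩ := Submodule.mem_span_pair.1 hv
  have hxy : x ≠ 0 ∨ y ≠ 0 := by
    by_contra! h
    exact hv0 (by simp [h.1, h.2])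
  have hval : β (x • a + y • b) (x • a + y • b) = x ^ 2 * β a a + y ^ 2 * β b b := by
    simp [hab, hba]
    ring
  change 0 < β (x • a + y • b) (x • a + y • b)
  rw [hval]
  rcases hxy with h | h <;> positivity

theorem realPoints_ne_bot_of_sigPos_eq_one (hsymm : ∀ u v, β u v = β v u)
    (hpos : sigPos (LinearMap.BilinMap.toQuadraticMap β : QuadraticForm ℝ V) = 1)
    (hD : IsIsotropic β D) (hdim : Module.finrank ℝ V = 2 * Module.finrank ℂ D) :
    realPoints D ≠ ⊥ := by
  intro hbot
  obtain ⟨P, hP, hPpos⟩ := exists_finrank_eq_sigPos_and_posDef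
    (LinearMap.BilinMap.toQuadraticMap β : QuadraticForm ℝ V)
  have : Nontrivial P := Module.nontrivial_of_finrank_pos (R := ℝ) (by omega)
  obtain ⟨a, ha⟩ := exists_ne (0 : P)
  have haa : 0 < β a a := hPpos a ha
  obtain ⟨b, hab⟩ := exists_complexVector_mem_of_realPoints_eq_bot hdim hbot (a : V)
  have hnull := hD _ hab _ hab
  rw [baseChange_complexVector, Complex.ext_iff] at hnull
  obtain ⟨hre : β a a - β b b = 0, him : β a b + β b a = 0⟩ := hnull
  have hb : 0 < β b b := by linarith
  have hab0 : β a b = 0 := by linarith [hsymm a b]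
  have := two_le_sigPos_of_orthogonal hsymm hab0 haa hb
  omega

theorem finrank_realPoints_le_one_of_sigPos
    (hpos : sigPos (LinearMap.BilinMap.toQuadraticMap β : QuadraticForm ℝ V) + 1 =
      Module.finrank ℝ V) (hD : IsIsotropic β D) :
    Module.finrank ℝ (realPoints D) ≤ 1 := by
  have h := QuadraticForm.sigPos_add_finrank_le_of_nonpos
    (Q := (LinearMap.BilinMap.toQuadraticMap β : QuadraticForm ℝ V)) (V := realPoints D)
    fun v hv => (apply_eq_zero_of_mem_realPoints hD hv hv).le
  omega

theorem finrank_inf_conjugate_eq_one_of_isLorentzian (hsymm : ∀ u v, β u v = β v u)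
    (hL : IsLorentzian β) (hD : IsIsotropic β D)
    (hdim : Module.finrank ℝ V = 2 * Module.finrank ℂ D) :
    Module.finrank ℂ ↥(D ⊓ conjugate D) = 1 := by
  rw [finrank_inf_conjugate]
  have hneg : (LinearMap.BilinMap.toQuadraticMap (-β) : QuadraticForm ℝ V) =
      -LinearMap.BilinMap.toQuadraticMap β := by ext; simp
  obtain ⟨hne, hle⟩ : realPoints D ≠ ⊥ ∧ Module.finrank ℝ (realPoints D) ≤ 1 := by
    rcases hL with ⟨h₁, h₂⟩ | ⟨h₁, h₂⟩
    · exact ⟨realPoints_ne_bot_of_sigPos_eq_one hsymm h₁ hD hdim,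
        finrank_realPoints_le_one_of_sigPos (by rw [hneg, sigPos_neg, h₂]) (isIsotropic_neg hD)⟩
    · exact ⟨realPoints_ne_bot_of_sigPos_eq_one (β := -β) (by simpa using hsymm)
          (by rw [hneg, sigPos_neg, h₁]) (isIsotropic_neg hD) hdim,
        finrank_realPoints_le_one_of_sigPos h₂ hD⟩
  have := Submodule.one_le_finrank_iff.2 hne
  omega

end MaximalIsotropic

theorem realPoints_eq_span_singleton {D : Submodule ℂ (ℂ ⊗[ℝ] V)}
    (hD : Module.finrank ℂ ↥(D ⊓ conjugate D) = 1) {k : V} (hk : k ∈ realPoints D) (hk0 : k ≠ 0) :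
    realPoints D = Submodule.span ℝ {k} :=
  eq_span_singleton_of_mem_of_finrank_eq_one (finrank_inf_conjugate D ▸ hD) hk hk0

theorem inf_conjugate_eq_span_singleton {D : Submodule ℂ (ℂ ⊗[ℝ] V)} {k : V}
    (hk : realPoints D = Submodule.span ℝ {k}) :
    D ⊓ conjugate D = Submodule.span ℂ {(1 : ℂ) ⊗ₜ[ℝ] k} := by
  rw [inf_conjugate_eq_baseChange_realPoints, hk, Submodule.baseChange_span, Set.image_singleton]
  rfl

end Complexification

section Covectors

theorem isInvertible_of_injective_toDual {𝕜 : Type*} [RCLike 𝕜] {E : Type*} [NormedAddCommGroup E]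
    [NormedSpace 𝕜 E] [FiniteDimensional 𝕜 E] {T : E →L[𝕜] E →L[𝕜] 𝕜}
    (hT : Function.Injective T) : T.IsInvertible := by
  let e := LinearMap.toContinuousLinearMap (𝕜 := 𝕜) (E := E) (F' := 𝕜)
  have : FiniteDimensional 𝕜 (E →L[𝕜] 𝕜) := e.finiteDimensional
  have hdim : Module.finrank 𝕜 E = Module.finrank 𝕜 (E →L[𝕜] 𝕜) :=
    Subspace.dual_finrank_eq.symm.trans e.finrank_eq
  exact ⟨(LinearEquiv.ofInjectiveOfFinrankEq (T : E →ₗ[𝕜] E →L[𝕜] 𝕜) hT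
    hdim).toContinuousLinearEquiv, by ext; rfl⟩

theorem contDiffOn_inverse_apply {𝕜 V E F : Type*} [RCLike 𝕜] [NormedAddCommGroup V]
    [NormedSpace 𝕜 V] [NormedAddCommGroup E] [NormedSpace 𝕜 E] [CompleteSpace E]
    [NormedAddCommGroup F] [NormedSpace 𝕜 F] {n : WithTop ℕ∞} {Q : V → E →L[𝕜] F} {S : Set V}
    (hQ : ContDiffOn 𝕜 n Q S) (τ : F) :
    ContDiffOn 𝕜 n (fun y => (Q y).inverse τ) (S ∩ Q ⁻¹' {A | A.IsInvertible}) := by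
  rintro y ⟨hy, e, he⟩
  have hinv : ContDiffAt 𝕜 n ContinuousLinearMap.inverse (Q y) := he ▸ contDiffAt_map_inverse e
  exact (hinv.comp_contDiffWithinAt y ((hQ y hy).mono Set.inter_subset_left)).clm_apply
    contDiffWithinAt_const

variable {E : Type*} [NormedAddCommGroup E] [NormedSpace ℝ E] {ι : Type*}

/-- The Gram operator `u ↦ ∑ i, α i u • α i` of a finite family of covectors: a positive
semidefinite form on `E` whose kernel is the common kernel of the family. -/
def gramOperator [Fintype ι] (α : ι → E →L[ℝ] ℝ) : E →L[ℝ] E →L[ℝ] ℝ :=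
  ∑ i, (α i).smulRight (α i)

theorem gramOperator_apply [Fintype ι] (α : ι → E →L[ℝ] ℝ) (u : E) :
    gramOperator α u = ∑ i, α i u • α i := by
  simp [gramOperator]

theorem gramOperator_eq_zero_iff [Fintype ι] {α : ι → E →L[ℝ] ℝ} {u : E} :
    gramOperator α u = 0 ↔ ∀ i, α i u = 0 := by
  refine ⟨fun h i => ?_, fun h => by simp [gramOperator_apply, h]⟩
  have hsum : ∑ i, α i u * α i u = 0 := by
    simpa [gramOperator_apply, sum_apply] using congrArg (fun L => L u) h
  rw [Finset.sum_eq_zero_iff_of_nonneg fun i _ => mul_self_nonneg _] at hsum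
  exact mul_self_eq_zero.1 (hsum i (Finset.mem_univ i))

theorem inverse_gramOperator_apply [Fintype ι] {α : Option ι → E →L[ℝ] ℝ} {k : E}
    (hα : (gramOperator α).IsInvertible) (hk : ∀ i, α (some i) k = 0) (hk0 : k ≠ 0) :
    (gramOperator α).inverse (α none) = (α none k)⁻¹ • k := by
  have hker : gramOperator α k = α none k • α none := by
    simp [gramOperator_apply, Fintype.sum_option, hk]
  have hk1 : α none k ≠ 0 := fun h =>
    hk0 (hα.injective (by rw [hker, h, zero_smul, map_zero]))
  rw [hα.inverse_apply_eq, map_smul, hker, inv_smul_smul₀ hk1]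

theorem gramOperator_injective_of_iInf_ker_eq_span [Fintype ι] {α : Option ι → E →L[ℝ] ℝ} {k : E}
    (hk : ⨅ i, (α (some i)).ker = Submodule.span ℝ {k}) (hk1 : α none k = 1) :
    Function.Injective (gramOperator α) := by
  refine (injective_iff_map_eq_zero _).2 fun v hv => ?_
  have hα := gramOperator_eq_zero_iff.1 hv
  have hv_ker : v ∈ ⨅ i, (α (some i)).ker := (Submodule.mem_iInf _).2 fun i => hα (some i)
  obtain ⟨c, rfl⟩ := Submodule.mem_span_singleton.1 (hk ▸ hv_ker)
  have hc : c = 0 := by simpa [hk1] using hα none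
  rw [hc, zero_smul]

variable [FiniteDimensional ℝ E]

/-- Adding a covector `τ` that does not vanish on the kernel line at `y₀` makes the Gram operator
invertible near `y₀`, and its inverse maps `τ` into the kernel line. -/
theorem exists_contDiffOn_mem_iInf_ker [Finite ι] {n : WithTop ℕ∞} {S : Set E}
    {α : ι → E → E →L[ℝ] ℝ} (hS : IsOpen S) (hα : ∀ i, ContDiffOn ℝ n (α i) S)
    (hker : ∀ y ∈ S, Module.finrank ℝ ↥(⨅ i, (α i y).ker) = 1) {y₀ : E} (hy₀ : y₀ ∈ S) :
    ∃ (T : Set E) (k : E → E), IsOpen T ∧ y₀ ∈ T ∧ T ⊆ S ∧ ContDiffOn ℝ n k T ∧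
      ∀ y ∈ T, k y ≠ 0 ∧ k y ∈ ⨅ i, (α i y).ker := by
  have := Fintype.ofFinite ι
  have hline (y : E) (hy : y ∈ S) : ∃ v ≠ 0, ⨅ i, (α i y).ker = Submodule.span ℝ {v} := by
    obtain ⟨v, hv, hv0⟩ := Submodule.exists_mem_ne_zero_of_ne_bot (p := ⨅ i, (α i y).ker)
      fun h => zero_ne_one (by rw [← hker y hy, h, finrank_bot])
    exact ⟨v, hv0, eq_span_singleton_of_mem_of_finrank_eq_one (hker y hy) hv hv0⟩
  obtain ⟨k₀, hk₀, hspan₀⟩ := hline y₀ hy₀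
  obtain ⟨τ, hτ⟩ := SeparatingDual.exists_eq_one (R := ℝ) hk₀
  let α' (y : E) (o : Option ι) : E →L[ℝ] ℝ := o.elim τ fun i => α i y
  let Q (y : E) : E →L[ℝ] E →L[ℝ] ℝ := gramOperator (α' y)
  have hQ : ContDiffOn ℝ n Q S := by
    have hα' (o : Option ι) : ContDiffOn ℝ n (fun y => α' y o) S :=
      o.rec contDiffOn_const hα
    exact ContDiffOn.sum fun o _ => (hα' o).smulRight (hα' o)
  have hQ₀ : (Q y₀).IsInvertible := isInvertible_of_injective_toDual
    (gramOperator_injective_of_iInf_ker_eq_span (α := α' y₀) hspan₀ hτ)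
  refine ⟨S ∩ Q ⁻¹' {A | A.IsInvertible}, fun y => (Q y).inverse τ,
    hQ.continuousOn.isOpen_inter_preimage hS ContinuousLinearEquiv.isOpen, ⟨hy₀, hQ₀⟩,
    Set.inter_subset_left, contDiffOn_inverse_apply hQ τ, ?_⟩
  rintro y ⟨hy, hinv⟩
  obtain ⟨v, hv0, hspan⟩ := hline y hy
  have hv : v ∈ ⨅ i, (α i y).ker := hspan ▸ Submodule.mem_span_singleton_self v
  have hk : (Q y).inverse τ = (τ v)⁻¹ • v :=
    inverse_gramOperator_apply hinv ((Submodule.mem_iInf _).1 hv) hv0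
  refine ⟨fun h0 => ?_, show (Q y).inverse τ ∈ _ from hk ▸ Submodule.smul_mem _ _ hv⟩
  have hτ0 : τ = 0 := by
    rw [hinv.inverse_apply_eq.1 (h0 : (Q y).inverse τ = 0), map_zero]
  simp [hτ0] at hτ

theorem exists_accelerationForm_eq_smul_of_orthogonal {G : E → E →L[ℝ] E →L[ℝ] ℝ}
    {k : E → E} {w : ι → E → E} {y : E} (hG : DifferentiableAt ℝ G y)
    (hsymm : ∀ a b, G y a b = G y b a) (hnd : ∀ u, (∀ v, G y u v = 0) → u = 0)
    (hk : DifferentiableAt ℝ k y) (hw : ∀ i, DifferentiableAt ℝ (w i) y)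
    (hkk : ∀ᶠ z in 𝓝 y, G z (k z) (k z) = 0) (hkw : ∀ i, ∀ᶠ z in 𝓝 y, G z (k z) (w i z) = 0)
    (hbracket : ∀ i, G y (k y) (VectorField.lieBracket ℝ k (w i) y) = 0)
    (horth : ∀ v, (∀ i, G y v (w i y) = 0) → v ∈ Submodule.span ℝ {k y}) :
    ∃ r : ℝ, accelerationForm G y (k y) (fderiv ℝ k y (k y)) = r • G y (k y) := by
  have hinj : Function.Injective (G y) :=
    (injective_iff_map_eq_zero _).2 fun u hu => hnd u fun v => by rw [hu, zero_apply]
  obtain ⟨n, hn⟩ := (isInvertible_of_injective_toDual hinj).surjective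
    (accelerationForm G y (k y) (fderiv ℝ k y (k y)))
  have hn_span : n ∈ Submodule.span ℝ {k y} := horth n fun i => by
    rw [hn, accelerationForm_apply_eq_neg_lieBracket hG hsymm hk (hw i) hkk (hkw i), hbracket,
      neg_zero]
  obtain ⟨r, rfl⟩ := Submodule.mem_span_singleton.1 hn_span
  exact ⟨r, by rw [← hn, map_smul]⟩

end Covectors

section Chart

variable {𝕜 : Type*} [RCLike 𝕜] {E : Type*} [NormedAddCommGroup E] [NormedSpace 𝕜 E]
  {M : Type*} [TopologicalSpace M] [ChartedSpace E M]
  {g : ∀ x : M, TangentSpace 𝓘(𝕜, E) x →L[𝕜] TangentSpace 𝓘(𝕜, E) x →L[𝕜] 𝕜}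
  {V W : ∀ x : M, TangentSpace 𝓘(𝕜, E) x} {p : M} {y : E}

/-- The differential at `y` of the inverse of the preferred chart at `p`. -/
def chartDeriv (𝕜 : Type*) [RCLike 𝕜] {E : Type*} [NormedAddCommGroup E] [NormedSpace 𝕜 E]
    {M : Type*} [TopologicalSpace M] [ChartedSpace E M] (p : M) (y : E) :
    E →L[𝕜] TangentSpace 𝓘(𝕜, E) ((extChartAt 𝓘(𝕜, E) p).symm y) :=
  mfderiv 𝓘(𝕜, E) 𝓘(𝕜, E) (extChartAt 𝓘(𝕜, E) p).symm y

/-- The expression of a vector field in the preferred chart at `p`. -/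
def chartField (p : M) (V : ∀ x : M, TangentSpace 𝓘(𝕜, E) x) : E → E :=
  VectorField.mpullback 𝓘(𝕜, E) 𝓘(𝕜, E) (extChartAt 𝓘(𝕜, E) p).symm V

theorem inChart_apply (g : ∀ x : M, TangentSpace 𝓘(𝕜, E) x →L[𝕜] TangentSpace 𝓘(𝕜, E) x →L[𝕜] 𝕜)
    (p : M) (y u v : E) :
    inChart g p y u v = g ((extChartAt 𝓘(𝕜, E) p).symm y) (chartDeriv 𝕜 p y u)
      (chartDeriv 𝕜 p y v) := rfl

theorem inChart_symm {n : WithTop ℕ∞} (hg : IsMetric n g) (p : M) (y u v : E) :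
    inChart g p y u v = inChart g p y v u := by
  rw [inChart_apply, inChart_apply, hg.symm]

theorem isOpen_chart_preimage (p : M) {U : Set M} (hU : IsOpen U) :
    IsOpen ((extChartAt 𝓘(𝕜, E) p).target ∩ (extChartAt 𝓘(𝕜, E) p).symm ⁻¹' U) :=
  (continuousOn_extChartAt_symm p).isOpen_inter_preimage (isOpen_extChartAt_target p) hU

variable [IsManifold 𝓘(𝕜, E) 1 M]

theorem isInvertible_chartDeriv (hy : y ∈ (extChartAt 𝓘(𝕜, E) p).target) :
    (chartDeriv 𝕜 p y).IsInvertible := by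
  have h := isInvertible_mfderivWithin_extChartAt_symm (I := 𝓘(𝕜, E)) hy
  rwa [modelWithCornersSelf_coe, Set.range_id, mfderivWithin_univ] at h

theorem chartDeriv_chartField (V : ∀ x : M, TangentSpace 𝓘(𝕜, E) x)
    (hy : y ∈ (extChartAt 𝓘(𝕜, E) p).target) :
    chartDeriv 𝕜 p y (chartField p V y) = V ((extChartAt 𝓘(𝕜, E) p).symm y) :=
  ((isInvertible_chartDeriv hy).inverse_apply_eq.1 rfl).symm

theorem inChart_chartField_right (hy : y ∈ (extChartAt 𝓘(𝕜, E) p).target) (u : E) :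
    inChart g p y u (chartField p W y) = g ((extChartAt 𝓘(𝕜, E) p).symm y) (chartDeriv 𝕜 p y u)
      (W ((extChartAt 𝓘(𝕜, E) p).symm y)) := by
  rw [inChart_apply, chartDeriv_chartField W hy]

theorem inChart_chartField (hy : y ∈ (extChartAt 𝓘(𝕜, E) p).target) :
    inChart g p y (chartField p V y) (chartField p W y) =
      g ((extChartAt 𝓘(𝕜, E) p).symm y) (V ((extChartAt 𝓘(𝕜, E) p).symm y))
        (W ((extChartAt 𝓘(𝕜, E) p).symm y)) := by
  rw [inChart_chartField_right hy, chartDeriv_chartField V hy]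

theorem mfderiv_extChartAt_chartDeriv (hy : y ∈ (extChartAt 𝓘(𝕜, E) p).target) (v : E) :
    mfderiv 𝓘(𝕜, E) 𝓘(𝕜, E) (extChartAt 𝓘(𝕜, E) p) ((extChartAt 𝓘(𝕜, E) p).symm y)
      (chartDeriv 𝕜 p y v) = v := by
  have h := mfderiv_extChartAt_comp_mfderivWithin_extChartAt_symm (I := 𝓘(𝕜, E)) hy
  rw [modelWithCornersSelf_coe, Set.range_id, mfderivWithin_univ] at h
  exact congrArg (fun L => L v) h

theorem chartField_extChartAt (V : ∀ x : M, TangentSpace 𝓘(𝕜, E) x) {x : M}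
    (hx : x ∈ (extChartAt 𝓘(𝕜, E) p).source) :
    chartField p V (extChartAt 𝓘(𝕜, E) p x) =
      mfderiv 𝓘(𝕜, E) 𝓘(𝕜, E) (extChartAt 𝓘(𝕜, E) p) x (V x) := by
  obtain ⟨y, hy, rfl⟩ : ∃ y ∈ (extChartAt 𝓘(𝕜, E) p).target, (extChartAt 𝓘(𝕜, E) p).symm y = x :=
    ⟨_, (extChartAt 𝓘(𝕜, E) p).map_source hx, (extChartAt 𝓘(𝕜, E) p).left_inv hx⟩
  rw [(extChartAt 𝓘(𝕜, E) p).right_inv hy, ← chartDeriv_chartField V hy]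
  exact (mfderiv_extChartAt_chartDeriv hy _).symm

theorem mpullback_extChartAt_symm (k : E → E) (hy : y ∈ (extChartAt 𝓘(𝕜, E) p).target) :
    VectorField.mpullback 𝓘(𝕜, E) 𝓘(𝕜, E) (extChartAt 𝓘(𝕜, E) p) k
      ((extChartAt 𝓘(𝕜, E) p).symm y) = chartDeriv 𝕜 p y (k y) := by
  have hx := (extChartAt 𝓘(𝕜, E) p).map_target hy
  refine (isInvertible_mfderiv_extChartAt hx).inverse_apply_eq.2
    (Eq.trans ?_ (mfderiv_extChartAt_chartDeriv hy (k y)).symm)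
  exact congrArg k ((extChartAt 𝓘(𝕜, E) p).right_inv hy)

theorem nondegenerate_inChart {n : WithTop ℕ∞} (hg : IsMetric n g)
    (hy : y ∈ (extChartAt 𝓘(𝕜, E) p).target) {u : E} (hu : ∀ v, inChart g p y u v = 0) :
    u = 0 := by
  have hinv := isInvertible_chartDeriv hy
  refine hinv.injective ((hg.nondegenerate _ _ fun v => ?_).trans (map_zero _).symm)
  obtain ⟨w, rfl⟩ := hinv.surjective v
  exact hu w

theorem contDiffOn_chartField {n : WithTop ℕ∞} [IsManifold 𝓘(𝕜, E) (n + 1) M] [CompleteSpace E]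
    (p : M) {U : Set M} (hU : IsOpen U)
    (hV : ContMDiffOn 𝓘(𝕜, E) 𝓘(𝕜, E).tangent n
      (fun x => (⟨x, V x⟩ : TangentBundle 𝓘(𝕜, E) M)) U) :
    ContDiffOn 𝕜 n (chartField p V)
      ((extChartAt 𝓘(𝕜, E) p).target ∩ (extChartAt 𝓘(𝕜, E) p).symm ⁻¹' U) := by
  rintro y ⟨hy, hyU⟩
  have hpull := ContMDiffAt.mpullback_vectorField_preimage (hV.contMDiffAt (hU.mem_nhds hyU))
    ((contMDiffOn_extChartAt_symm p).contMDiffAt ((isOpen_extChartAt_target p).mem_nhds hy))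
    (isInvertible_chartDeriv (E := E) hy) le_rfl
  have hmk : ContMDiffAt 𝓘(𝕜, E) 𝓘(𝕜, E).tangent n
      (fun z => (⟨z, chartField (E := E) p V z⟩ : TangentBundle 𝓘(𝕜, E) E)) y := hpull
  exact (contMDiffAt_vectorSpace_iff_contDiffAt.1 hmk).contDiffWithinAt

theorem contMDiffOn_mpullback_extChartAt {n : WithTop ℕ∞} [IsManifold 𝓘(𝕜, E) (n + 1) M]
    [CompleteSpace E] (p : M) {k : E → E} {S : Set E} (hS : IsOpen S) (hk : ContDiffOn 𝕜 n k S) :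
    ContMDiffOn 𝓘(𝕜, E) 𝓘(𝕜, E).tangent n
      (fun x => (⟨x, VectorField.mpullback 𝓘(𝕜, E) 𝓘(𝕜, E) (extChartAt 𝓘(𝕜, E) p) k x⟩ :
        TangentBundle 𝓘(𝕜, E) M))
      ((extChartAt 𝓘(𝕜, E) p).source ∩ extChartAt 𝓘(𝕜, E) p ⁻¹' S) := by
  rintro x ⟨hx, hxS⟩
  exact (ContMDiffAt.mpullback_vectorField_preimage
    (contMDiffAt_vectorSpace_iff_contDiffAt.2 (hk.contDiffAt (hS.mem_nhds hxS)))
    (contMDiffAt_extChartAt' (extChartAt_source 𝓘(𝕜, E) p ▸ hx))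
    (isInvertible_mfderiv_extChartAt hx) le_rfl).contMDiffWithinAt

theorem fderiv_extChartAt_comp {E' : Type*} [NormedAddCommGroup E'] [NormedSpace 𝕜 E']
    {h : E' → M} {z : E'} (hh : MDifferentiableAt 𝓘(𝕜, E') 𝓘(𝕜, E) h z)
    (hz : h z ∈ (extChartAt 𝓘(𝕜, E) p).source) (v : E') :
    fderiv 𝕜 (fun z => extChartAt 𝓘(𝕜, E) p (h z)) z v =
      mfderiv 𝓘(𝕜, E) 𝓘(𝕜, E) (extChartAt 𝓘(𝕜, E) p) (h z)
        (mfderiv 𝓘(𝕜, E') 𝓘(𝕜, E) h z v) := by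
  rw [extChartAt_source] at hz
  have hcomp := mfderiv_comp z (mdifferentiableAt_extChartAt (I := 𝓘(𝕜, E)) hz) hh
  rw [mfderiv_eq_fderiv] at hcomp
  exact congrArg (fun L => L v) hcomp

theorem deriv_extChartAt_comp {γ : 𝕜 → M} {t : 𝕜} (hγ : MDifferentiableAt 𝓘(𝕜, 𝕜) 𝓘(𝕜, E) γ t)
    (ht : γ t ∈ (extChartAt 𝓘(𝕜, E) p).source) :
    deriv (fun s => extChartAt 𝓘(𝕜, E) p (γ s)) t =
      mfderiv 𝓘(𝕜, E) 𝓘(𝕜, E) (extChartAt 𝓘(𝕜, E) p) (γ t)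
        (mfderiv 𝓘(𝕜, 𝕜) 𝓘(𝕜, E) γ t (1 : 𝕜)) :=
  fderiv_apply_one_eq_deriv.symm.trans (fderiv_extChartAt_comp hγ ht 1)

theorem deriv_extChartAt_comp_ne_zero {γ : 𝕜 → M} {t : 𝕜}
    (hγ : MDifferentiableAt 𝓘(𝕜, 𝕜) 𝓘(𝕜, E) γ t) (ht : γ t ∈ (extChartAt 𝓘(𝕜, E) p).source)
    (hγ0 : mfderiv 𝓘(𝕜, 𝕜) 𝓘(𝕜, E) γ t ≠ 0) :
    deriv (fun s => extChartAt 𝓘(𝕜, E) p (γ s)) t ≠ 0 := fun h =>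
  hγ0 <| ContinuousLinearMap.ext_ring <| (isInvertible_mfderiv_extChartAt ht).injective
    ((deriv_extChartAt_comp hγ ht).symm.trans (h.trans (map_zero _).symm))

theorem deriv_extChartAt_comp_mem_span {γ : 𝕜 → M} {t : 𝕜}
    (hγ : MDifferentiableAt 𝓘(𝕜, 𝕜) 𝓘(𝕜, E) γ t) (ht : γ t ∈ (extChartAt 𝓘(𝕜, E) p).source)
    (hV : mfderiv 𝓘(𝕜, 𝕜) 𝓘(𝕜, E) γ t (1 : 𝕜) ∈ Submodule.span 𝕜 {V (γ t)}) :
    deriv (fun s => extChartAt 𝓘(𝕜, E) p (γ s)) t ∈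
      Submodule.span 𝕜 {chartField p V (extChartAt 𝓘(𝕜, E) p (γ t))} := by
  obtain ⟨r, hr⟩ := Submodule.mem_span_singleton.1 hV
  rw [deriv_extChartAt_comp hγ ht, ← hr, chartField_extChartAt V ht]
  exact Submodule.mem_span_singleton.2 ⟨r, (map_smul _ r _).symm⟩

theorem mlieBracket_eq_lieBracket (V W : ∀ y : E, TangentSpace 𝓘(𝕜, E) y) (y : E) :
    VectorField.mlieBracket 𝓘(𝕜, E) V W y = VectorField.lieBracket 𝕜 V W y :=
  (congrFun VectorField.mlieBracketWithin_univ y).symm.trans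
    ((congrFun VectorField.mlieBracketWithin_eq_lieBracketWithin y).trans
      (congrFun VectorField.lieBracketWithin_univ y))

theorem lieBracket_chartField [CompleteSpace E] [IsManifold 𝓘(𝕜, E) 3 M]
    (hy : y ∈ (extChartAt 𝓘(𝕜, E) p).target)
    (hV : MDifferentiableAt 𝓘(𝕜, E) 𝓘(𝕜, E).tangent
      (fun x => (⟨x, V x⟩ : TangentBundle 𝓘(𝕜, E) M)) ((extChartAt 𝓘(𝕜, E) p).symm y))
    (hW : MDifferentiableAt 𝓘(𝕜, E) 𝓘(𝕜, E).tangent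
      (fun x => (⟨x, W x⟩ : TangentBundle 𝓘(𝕜, E) M)) ((extChartAt 𝓘(𝕜, E) p).symm y)) :
    VectorField.lieBracket 𝕜 (chartField p V) (chartField p W) y =
      chartField p (VectorField.mlieBracket 𝓘(𝕜, E) V W) y := by
  have : IsManifold 𝓘(𝕜, E) (minSmoothness 𝕜 3) M := by simpa using ‹IsManifold 𝓘(𝕜, E) 3 M›
  have hsymm : ContMDiffAt 𝓘(𝕜, E) 𝓘(𝕜, E) 3 (extChartAt 𝓘(𝕜, E) p).symm y :=
    (contMDiffOn_extChartAt_symm p).contMDiffAt ((isOpen_extChartAt_target p).mem_nhds hy)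
  exact (mlieBracket_eq_lieBracket _ _ y).symm.trans
    (VectorField.mpullback_mlieBracket hV hW hsymm (by simp; norm_num)).symm

end Chart

section RealLine

variable {E : Type*} [NormedAddCommGroup E] [NormedSpace ℝ E] [FiniteDimensional ℝ E]
  {M : Type*} [TopologicalSpace M] [ChartedSpace E M]
  {g : ∀ x : M, TangentSpace 𝓘(ℝ, E) x →L[ℝ] TangentSpace 𝓘(ℝ, E) x →L[ℝ] ℝ}
  {D : ∀ x : M, Submodule ℂ (ℂ ⊗[ℝ] TangentSpace 𝓘(ℝ, E) x)} {m : ℕ}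

instance finiteDimensional_tangentSpace (x : M) : FiniteDimensional ℝ (TangentSpace 𝓘(ℝ, E) x) :=
  inferInstanceAs (FiniteDimensional ℝ E)

omit [FiniteDimensional ℝ E] in
theorem nondegenerate_bilin {n : WithTop ℕ∞} (hg : IsMetric n g) (x : M) :
    (bilin g x).Nondegenerate :=
  ⟨hg.nondegenerate x, fun w hw => hg.nondegenerate x w fun v => (hg.symm _ _ _).trans (hw v)⟩

omit [FiniteDimensional ℝ E] in
theorem finrank_of_isComplexDistribution [IsManifold 𝓘(ℝ, E) 1 M] {n : WithTop ℕ∞}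
    (hD : IsComplexDistribution n m D) (x : M) : Module.finrank ℂ (D x) = m := by
  obtain ⟨U, A, B, -, hx, -, -, h⟩ := hD x
  obtain ⟨hind, hspan⟩ := h x hx
  rw [hspan, finrank_span_eq_card hind, Fintype.card_fin]

variable [IsManifold 𝓘(ℝ, E) ∞ M] {ι : Type*}

/-- The smooth real vector fields `W (inl i)` and `W (inr i)` on the open set `U` are the real and
imaginary parts of complex fields that span `D` over `U`. -/
structure IsRealFrame (D : ∀ x : M, Submodule ℂ (ℂ ⊗[ℝ] TangentSpace 𝓘(ℝ, E) x)) (U : Set M)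
    (W : ι ⊕ ι → ∀ x : M, TangentSpace 𝓘(ℝ, E) x) : Prop where
  isOpen : IsOpen U
  contMDiffOn : ∀ i, ContMDiffOn 𝓘(ℝ, E) 𝓘(ℝ, E).tangent ∞
    (fun x => (⟨x, W i x⟩ : TangentBundle 𝓘(ℝ, E) M)) U
  eq_span : ∀ x ∈ U, D x =
    Submodule.span ℂ (Set.range fun i => complexVector (W (.inl i) x) (W (.inr i) x))

omit [FiniteDimensional ℝ E] in
theorem exists_isRealFrame (hD : IsComplexDistribution ∞ m D) (p : M) :
    ∃ (U : Set M) (W : Fin m ⊕ Fin m → ∀ x : M, TangentSpace 𝓘(ℝ, E) x),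
      p ∈ U ∧ IsRealFrame D U W := by
  obtain ⟨U, A, B, hU, hp, hA, hB, hspan⟩ := hD p
  exact ⟨U, Sum.elim A B, hp, hU, Sum.rec hA hB, fun x hx => (hspan x hx).2⟩

namespace IsRealFrame

variable {U : Set M} {W : ι ⊕ ι → ∀ x : M, TangentSpace 𝓘(ℝ, E) x}

omit [FiniteDimensional ℝ E] in
theorem mono (hW : IsRealFrame D U W) {U' : Set M} (hU' : IsOpen U') (hsub : U' ⊆ U) :
    IsRealFrame D U' W :=
  ⟨hU', fun i => (hW.contMDiffOn i).mono hsub, fun x hx => hW.eq_span x (hsub hx)⟩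

omit [FiniteDimensional ℝ E] in
theorem complexVector_mem (hW : IsRealFrame D U W) {x : M} (hx : x ∈ U) (i : ι) :
    complexVector (W (.inl i) x) (W (.inr i) x) ∈ D x := by
  rw [hW.eq_span x hx]
  exact Submodule.subset_span ⟨i, rfl⟩

omit [FiniteDimensional ℝ E] in
theorem apply_eq_zero (hW : IsRealFrame D U W) {x : M} (hiso : IsIsotropic (bilin g x) (D x))
    (hx : x ∈ U) {k : TangentSpace 𝓘(ℝ, E) x} (hk : k ∈ realPoints (D x)) (i : ι ⊕ ι) :
    g x k (W i x) = 0 := by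
  rcases i with i | i
  · exact (apply_eq_zero_of_complexVector_mem hiso hk (hW.complexVector_mem hx i)).1
  · exact (apply_eq_zero_of_complexVector_mem hiso hk (hW.complexVector_mem hx i)).2

theorem mem_realPoints_iff (hW : IsRealFrame D U W) {n : WithTop ℕ∞} (hg : IsMetric n g) {x : M}
    (hiso : IsIsotropic (bilin g x) (D x))
    (hdim : Module.finrank ℝ E = 2 * Module.finrank ℂ (D x)) (hx : x ∈ U)
    {v : TangentSpace 𝓘(ℝ, E) x} : v ∈ realPoints (D x) ↔ ∀ i, g x (W i x) v = 0 := by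
  refine (mem_realPoints_iff_of_eq_span (nondegenerate_bilin hg x) hiso hdim
    (hW.eq_span x hx)).trans ?_
  rw [Sum.forall, forall_and]
  rfl

theorem iInf_ker_eq_comap_realPoints (hW : IsRealFrame D U W) {n : WithTop ℕ∞}
    (hg : IsMetric n g) {p : M} {y : E} (hy : y ∈ (extChartAt 𝓘(ℝ, E) p).target)
    (hyU : (extChartAt 𝓘(ℝ, E) p).symm y ∈ U)
    (hiso : IsIsotropic (bilin g ((extChartAt 𝓘(ℝ, E) p).symm y))
      (D ((extChartAt 𝓘(ℝ, E) p).symm y)))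
    (hdim : Module.finrank ℝ E = 2 * Module.finrank ℂ (D ((extChartAt 𝓘(ℝ, E) p).symm y))) :
    ⨅ i, (inChart g p y (chartField p (W i) y)).ker =
      (realPoints (D ((extChartAt 𝓘(ℝ, E) p).symm y))).comap (chartDeriv ℝ p y).toLinearMap := by
  ext v
  refine Submodule.mem_iInf _ |>.trans (Iff.trans ?_
    (hW.mem_realPoints_iff hg hiso hdim hyU (v := chartDeriv ℝ p y v)).symm)
  refine forall_congr' fun i => LinearMap.mem_ker.trans ?_
  exact Eq.congr_left ((inChart_symm hg p y _ v).trans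
    ((inChart_chartField_right hy v).trans (hg.symm _ _ _)))

omit [FiniteDimensional ℝ E] in
theorem apply_mlieBracket_eq_zero (hW : IsRealFrame D U W)
    (hiso : ∀ x, IsIsotropic (bilin g x) (D x)) (hint : IsIntegrable D)
    {k : ∀ x : M, TangentSpace 𝓘(ℝ, E) x}
    (hk : ContMDiffOn 𝓘(ℝ, E) 𝓘(ℝ, E).tangent ∞
      (fun x => (⟨x, k x⟩ : TangentBundle 𝓘(ℝ, E) M)) U)
    (hkD : ∀ x ∈ U, k x ∈ realPoints (D x)) {x : M} (hx : x ∈ U) (i : ι ⊕ ι) :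
    g x (k x) (VectorField.mlieBracket 𝓘(ℝ, E) k (W i) x) = 0 := by
  have hzero : ContMDiffOn 𝓘(ℝ, E) 𝓘(ℝ, E).tangent ∞
      (fun x => (⟨x, 0⟩ : TangentBundle 𝓘(ℝ, E) M)) U :=
    (Bundle.contMDiff_zeroSection ℝ (TangentSpace 𝓘(ℝ, E) : M → Type _)).contMDiffOn
  have hbracket (i : ι) : complexVector (VectorField.mlieBracket 𝓘(ℝ, E) k (W (.inl i)) x)
      (VectorField.mlieBracket 𝓘(ℝ, E) k (W (.inr i)) x) ∈ D x := by
    have h := hint U k 0 (W (.inl i)) (W (.inr i)) hW.isOpen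
      (by simpa using ⟨hk, hzero, hW.contMDiffOn (.inl i), hW.contMDiffOn (.inr i)⟩)
      (fun x hx => ⟨(complexVector_zero_right (k x)).symm ▸ hkD x hx, hW.complexVector_mem hx i⟩)
      x hx
    rw [VectorField.mlieBracket_zero_left, VectorField.mlieBracket_zero_left] at h
    change complexVector (_ - (0 : TangentSpace 𝓘(ℝ, E) x)) (_ + (0 : TangentSpace 𝓘(ℝ, E) x)) ∈ _
      at h
    rwa [sub_zero, add_zero] at h
  rcases i with i | i
  · exact (apply_eq_zero_of_complexVector_mem (hiso x) (hkD x hx) (hbracket i)).1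
  · exact (apply_eq_zero_of_complexVector_mem (hiso x) (hkD x hx) (hbracket i)).2

end IsRealFrame

omit [FiniteDimensional ℝ E] in
theorem finrank_comap_chartDeriv {p : M} {y : E} (hy : y ∈ (extChartAt 𝓘(ℝ, E) p).target)
    (R : Submodule ℝ (TangentSpace 𝓘(ℝ, E) ((extChartAt 𝓘(ℝ, E) p).symm y))) :
    Module.finrank ℝ (R.comap (chartDeriv ℝ p y).toLinearMap) = Module.finrank ℝ R := by
  have : IsManifold 𝓘(ℝ, E) 1 M := IsManifold.of_le (n := ∞) (WithTop.coe_le_coe.2 le_top)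
  obtain ⟨e, he⟩ := isInvertible_chartDeriv (E := E) hy
  rw [← he]
  exact (Submodule.comap_equiv_eq_map_symm e.toLinearEquiv R).symm ▸
    e.toLinearEquiv.symm.finrank_map_eq R

/-- The real points of `D` are the common kernel of the covectors `g (W i, ·)`. -/
theorem exists_contMDiffOn_mem_realPoints (hm : Module.finrank ℝ E = 2 * m) (hg : IsMetric ∞ g)
    (hD : IsComplexDistribution ∞ m D) (hiso : ∀ x, IsIsotropic (bilin g x) (D x))
    (hline : ∀ x, Module.finrank ℂ ↥(D x ⊓ conjugate (D x)) = 1) (p : M) :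
    ∃ (U : Set M) (k : ∀ x : M, TangentSpace 𝓘(ℝ, E) x), IsOpen U ∧ p ∈ U ∧
      ContMDiffOn 𝓘(ℝ, E) 𝓘(ℝ, E).tangent ∞
        (fun x => (⟨x, k x⟩ : TangentBundle 𝓘(ℝ, E) M)) U ∧
      ∀ x ∈ U, k x ≠ 0 ∧ k x ∈ realPoints (D x) := by
  have : IsManifold 𝓘(ℝ, E) (∞ + 1) M := ‹IsManifold 𝓘(ℝ, E) ∞ M›
  have : CompleteSpace E := FiniteDimensional.complete ℝ E
  have hdim (x : M) : Module.finrank ℝ E = 2 * Module.finrank ℂ (D x) := by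
    rw [finrank_of_isComplexDistribution hD, hm]
  obtain ⟨U, W, hp, hW⟩ := exists_isRealFrame hD p
  set S : Set E := (extChartAt 𝓘(ℝ, E) p).target ∩ (extChartAt 𝓘(ℝ, E) p).symm ⁻¹' U
  have hpS : extChartAt 𝓘(ℝ, E) p p ∈ S :=
    ⟨mem_extChartAt_target p, by rwa [Set.mem_preimage, extChartAt_to_inv]⟩
  have hker (y : E) (hy : y ∈ S) :=
    hW.iInf_ker_eq_comap_realPoints hg hy.1 hy.2 (hiso _) (hdim _)
  obtain ⟨T, k, hT, hpT, hTS, hk, hk0⟩ := exists_contDiffOn_mem_iInf_ker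
    (α := fun i y => inChart g p y (chartField p (W i) y)) (isOpen_chart_preimage p hW.isOpen)
    (fun i => ((hg.contDiffOn p).mono Set.inter_subset_left).clm_apply
      (contDiffOn_chartField p hW.isOpen (hW.contMDiffOn i)))
    (fun y hy => by
      rw [hker y hy, finrank_comap_chartDeriv hy.1, ← finrank_inf_conjugate, hline]) hpS
  refine ⟨_, VectorField.mpullback 𝓘(ℝ, E) 𝓘(ℝ, E) (extChartAt 𝓘(ℝ, E) p) k,
    (continuousOn_extChartAt p).isOpen_inter_preimage (isOpen_extChartAt_source p) hT,
    ⟨mem_extChartAt_source p, hpT⟩, contMDiffOn_mpullback_extChartAt p hT hk, ?_⟩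
  rintro x ⟨hx, hxT⟩
  obtain ⟨y, hy, rfl⟩ : ∃ y ∈ (extChartAt 𝓘(ℝ, E) p).target, (extChartAt 𝓘(ℝ, E) p).symm y = x :=
    ⟨_, (extChartAt 𝓘(ℝ, E) p).map_source hx, (extChartAt 𝓘(ℝ, E) p).left_inv hx⟩
  rw [Set.mem_preimage, (extChartAt 𝓘(ℝ, E) p).right_inv hy] at hxT
  rw [mpullback_extChartAt_symm k hy]
  obtain ⟨hne, hmem⟩ := hk0 y hxT
  exact ⟨fun h => hne ((isInvertible_chartDeriv (E := E) hy).injective (h.trans (map_zero _).symm)),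
    (hker y (hTS hxT)).le hmem⟩

theorem exists_null_section (hm : Module.finrank ℝ E = 2 * m) (hg : IsMetric ∞ g)
    (hD : IsComplexDistribution ∞ m D) (hiso : ∀ x, IsIsotropic (bilin g x) (D x))
    (hline : ∀ x, Module.finrank ℂ ↥(D x ⊓ conjugate (D x)) = 1) (p : M) :
    ∃ (U : Set M) (k : ∀ x : M, TangentSpace 𝓘(ℝ, E) x), IsOpen U ∧ p ∈ U ∧
      ContMDiffOn 𝓘(ℝ, E) 𝓘(ℝ, E).tangent ∞
        (fun x => (⟨x, k x⟩ : TangentBundle 𝓘(ℝ, E) M)) U ∧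
      ∀ x ∈ U, k x ≠ 0 ∧ g x (k x) (k x) = 0 ∧
        D x ⊓ conjugate (D x) = Submodule.span ℂ {(1 : ℂ) ⊗ₜ[ℝ] k x} := by
  obtain ⟨U, k, hU, hp, hk, hkD⟩ := exists_contMDiffOn_mem_realPoints hm hg hD hiso hline p
  refine ⟨U, k, hU, hp, hk, fun x hx => ?_⟩
  obtain ⟨hk0, hkx⟩ := hkD x hx
  exact ⟨hk0, apply_eq_zero_of_mem_realPoints (hiso x) hkx hkx,
    inf_conjugate_eq_span_singleton (realPoints_eq_span_singleton (hline x) hkx hk0)⟩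

theorem exists_accelerationForm_chartField_eq_smul (hm : Module.finrank ℝ E = 2 * m)
    (hg : IsMetric ∞ g) (hD : IsComplexDistribution ∞ m D)
    (hiso : ∀ x, IsIsotropic (bilin g x) (D x)) (hint : IsIntegrable D)
    {U : Set M} (hU : IsOpen U) {k : ∀ x : M, TangentSpace 𝓘(ℝ, E) x}
    (hk : ContMDiffOn 𝓘(ℝ, E) 𝓘(ℝ, E).tangent ∞
      (fun x => (⟨x, k x⟩ : TangentBundle 𝓘(ℝ, E) M)) U)
    (hkD : ∀ x ∈ U, realPoints (D x) = Submodule.span ℝ {k x}) {p : M} {y : E}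
    (hy : y ∈ (extChartAt 𝓘(ℝ, E) p).target) (hyU : (extChartAt 𝓘(ℝ, E) p).symm y ∈ U) :
    ∃ r : ℝ, accelerationForm (inChart g p) y (chartField p k y)
      (fderiv ℝ (chartField p k) y (chartField p k y)) = r • inChart g p y (chartField p k y) := by
  have : IsManifold 𝓘(ℝ, E) (∞ + 1) M := ‹IsManifold 𝓘(ℝ, E) ∞ M›
  have : IsManifold 𝓘(ℝ, E) 3 M := IsManifold.of_le (n := ∞) (WithTop.coe_le_coe.2 le_top)
  have : CompleteSpace E := FiniteDimensional.complete ℝ E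
  obtain ⟨U₀, W₀, hyU₀, hW₀⟩ := exists_isRealFrame hD ((extChartAt 𝓘(ℝ, E) p).symm y)
  have hW := hW₀.mono (hU.inter hW₀.isOpen) Set.inter_subset_right
  replace hyU : (extChartAt 𝓘(ℝ, E) p).symm y ∈ U ∩ U₀ := ⟨hyU, hyU₀⟩
  replace hk := hk.mono (Set.inter_subset_left : U ∩ U₀ ⊆ U)
  have hkmem (x : M) (hx : x ∈ U ∩ U₀) : k x ∈ realPoints (D x) :=
    (hkD x hx.1).symm ▸ Submodule.mem_span_singleton_self _
  have hS := (isOpen_chart_preimage p hW.isOpen).mem_nhds ⟨hy, hyU⟩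
  have hdiff {V : ∀ x : M, TangentSpace 𝓘(ℝ, E) x} (hV : ContMDiffOn 𝓘(ℝ, E) 𝓘(ℝ, E).tangent ∞
      (fun x => (⟨x, V x⟩ : TangentBundle 𝓘(ℝ, E) M)) (U ∩ U₀)) :=
    ((contDiffOn_chartField p hW.isOpen hV).contDiffAt hS).differentiableAt (by simp)
  have hmdiff {V : ∀ x : M, TangentSpace 𝓘(ℝ, E) x} (hV : ContMDiffOn 𝓘(ℝ, E) 𝓘(ℝ, E).tangent ∞
      (fun x => (⟨x, V x⟩ : TangentBundle 𝓘(ℝ, E) M)) (U ∩ U₀)) :=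
    (hV.contMDiffAt (hW.isOpen.mem_nhds hyU)).mdifferentiableAt (by simp)
  refine exists_accelerationForm_eq_smul_of_orthogonal (w := fun i => chartField p (W₀ i))
    (((hg.contDiffOn p).contDiffAt ((isOpen_extChartAt_target p).mem_nhds hy)).differentiableAt
      (by simp))
    (inChart_symm hg p y) (fun u => nondegenerate_inChart hg hy) (hdiff hk)
    (fun i => hdiff (hW.contMDiffOn i)) ?_ (fun i => ?_) (fun i => ?_) fun v hv => ?_
  · filter_upwards [hS] with z hz
    exact (inChart_chartField hz.1).trans
      (apply_eq_zero_of_mem_realPoints (hiso _) (hkmem _ hz.2) (hkmem _ hz.2))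
  · filter_upwards [hS] with z hz
    exact (inChart_chartField hz.1).trans (hW.apply_eq_zero (hiso _) hz.2 (hkmem _ hz.2) i)
  · rw [lieBracket_chartField hy (hmdiff hk) (hmdiff (hW.contMDiffOn i))]
    exact (inChart_chartField hy).trans (hW.apply_mlieBracket_eq_zero hiso hint hk hkmem hyU i)
  · have hmem : chartDeriv ℝ p y v ∈ realPoints (D ((extChartAt 𝓘(ℝ, E) p).symm y)) :=
      (hW.mem_realPoints_iff hg (hiso _) (by rw [finrank_of_isComplexDistribution hD, hm]) hyU).2
        fun i => (hg.symm _ _ _).trans ((inChart_chartField_right hy v).symm.trans (hv i))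
    rw [hkD _ hyU.1] at hmem
    obtain ⟨r, hr⟩ := Submodule.mem_span_singleton.1 hmem
    refine Submodule.mem_span_singleton.2
      ⟨r, (isInvertible_chartDeriv (E := E) hy).injective (Eq.trans ?_ hr)⟩
    rw [map_smul, chartDeriv_chartField k hy]

theorem isUnparametrizedGeodesicAt_of_mem (hm : Module.finrank ℝ E = 2 * m) (hg : IsMetric ∞ g)
    (hD : IsComplexDistribution ∞ m D) (hiso : ∀ x, IsIsotropic (bilin g x) (D x))
    (hint : IsIntegrable D) (hline : ∀ x, Module.finrank ℂ ↥(D x ⊓ conjugate (D x)) = 1)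
    {γ : ℝ → M} {t₀ : ℝ} (hγ : ContMDiffAt 𝓘(ℝ, ℝ) 𝓘(ℝ, E) 2 γ t₀)
    (hγ0 : mfderiv 𝓘(ℝ, ℝ) 𝓘(ℝ, E) γ t₀ ≠ 0)
    (hγD : ∀ᶠ t in 𝓝 t₀, (1 : ℂ) ⊗ₜ[ℝ] mfderiv 𝓘(ℝ, ℝ) 𝓘(ℝ, E) γ t (1 : ℝ) ∈
      D (γ t) ⊓ conjugate (D (γ t))) : IsUnparametrizedGeodesicAt g γ t₀ := by
  have : IsManifold 𝓘(ℝ, E) (∞ + 1) M := ‹IsManifold 𝓘(ℝ, E) ∞ M›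
  have : IsManifold 𝓘(ℝ, E) 2 M := IsManifold.of_le (n := ∞) (WithTop.coe_le_coe.2 le_top)
  have : IsManifold 𝓘(ℝ, E) 1 M := IsManifold.of_le (n := ∞) (WithTop.coe_le_coe.2 le_top)
  have : CompleteSpace E := FiniteDimensional.complete ℝ E
  obtain ⟨U, k, hU, hpU, hk, hkD⟩ := exists_contMDiffOn_mem_realPoints hm hg hD hiso hline (γ t₀)
  have hspan (x : M) (hx : x ∈ U) : realPoints (D x) = Submodule.span ℝ {k x} :=
    realPoints_eq_span_singleton (hline x) (hkD x hx).2 (hkD x hx).1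
  set φ := extChartAt 𝓘(ℝ, E) (γ t₀)
  set c : ℝ → E := fun t => φ (γ t)
  have hc : ContDiffAt ℝ 2 c t₀ := (contMDiffAt_extChartAt.comp t₀ hγ).contDiffAt
  have hsource : ∀ᶠ t in 𝓝 t₀, γ t ∈ φ.source :=
    hγ.continuousAt.eventually_mem (extChartAt_source_mem_nhds (γ t₀))
  have hγU : ∀ᶠ t in 𝓝 t₀, γ t ∈ U := hγ.continuousAt.eventually_mem (hU.mem_nhds hpU)
  have hγdiff : ∀ᶠ t in 𝓝 t₀, MDifferentiableAt 𝓘(ℝ, ℝ) 𝓘(ℝ, E) γ t :=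
    ((contMDiffAt_iff_contMDiffAt_nhds (by norm_num)).1 hγ).mono
      fun t ht => ht.mdifferentiableAt two_ne_zero
  have hc0 : deriv c t₀ ≠ 0 :=
    deriv_extChartAt_comp_ne_zero hγdiff.self_of_nhds (mem_extChartAt_source _) hγ0
  have hck : ∀ᶠ t in 𝓝 t₀, deriv c t ∈ Submodule.span ℝ {chartField (γ t₀) k (c t)} := by
    filter_upwards [hγdiff, hsource, hγU, hγD] with t ht hs htU htD
    exact deriv_extChartAt_comp_mem_span ht hs
      ((hspan _ htU).le (one_tmul_mem_inf_conjugate_iff.1 htD))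
  refine ⟨hγ, hγ0, ?_⟩
  filter_upwards [hc.eventually (by simp),
    (differentiableAt_deriv hc).continuousAt.eventually_ne hc0, hck.eventually_nhds, hsource, hγU]
    with t hct hct0 hckt hs htU
  have hct_target : c t ∈ φ.target := φ.map_source hs
  have hctU : φ.symm (c t) ∈ U := (φ.left_inv hs).symm ▸ htU
  have hkc := ((contDiffOn_chartField (γ t₀) hU hk).contDiffAt
    ((isOpen_chart_preimage (γ t₀) hU).mem_nhds ⟨hct_target, hctU⟩)).differentiableAt (by simp)
  have hkc0 : chartField (γ t₀) k (c t) ≠ 0 := fun h => (hkD _ hctU).1 <|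
    (chartDeriv_chartField k hct_target).symm.trans
      ((congrArg (chartDeriv ℝ _ _) h).trans (map_zero _))
  obtain ⟨r, hr⟩ := exists_accelerationForm_chartField_eq_smul hm hg hD hiso hint hU hk hspan
    hct_target hctU
  obtain ⟨a, ha⟩ := exists_accelerationForm_eq_smul_of_deriv_mem_span hct hct0 hkc hkc0 hckt hr
  exact ⟨a, fun w => (accelerationForm_apply _ _ _ w).symm.trans (congrArg (fun L => L w) ha)⟩

end RealLine

section IdentityTheorem

variable {E : Type*} [NormedAddCommGroup E] [NormedSpace ℝ E]
  {F : Type*} [NormedAddCommGroup F] [NormedSpace ℂ F]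
  {F' : Type*} [NormedAddCommGroup F'] [NormedSpace ℂ F']

theorem eventually_span_range_fderiv_eq_top [FiniteDimensional ℂ F] {ψ : E → F} {y : E}
    (hψ : ContDiffAt ℝ 1 ψ y) (hspan : Submodule.span ℂ (Set.range (fderiv ℝ ψ y)) = ⊤) :
    ∀ᶠ z in 𝓝 y, Submodule.span ℂ (Set.range (fderiv ℝ ψ z)) = ⊤ := by
  obtain ⟨b, hbs, hb, hind⟩ := exists_linearIndependent ℂ (Set.range (fderiv ℝ ψ y))
  have : Finite b := hind.finite
  have : Fintype b := Fintype.ofFinite b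
  choose u hu using fun i : b => hbs i.2
  have hcard : Fintype.card b = Module.finrank ℂ F := by
    rw [← finrank_span_eq_card hind, Subtype.range_coe, hb, hspan, finrank_top]
  have hcont : ContinuousAt (fun z => fun i : b => fderiv ℝ ψ z (u i)) y :=
    continuousAt_pi.2 fun i =>
      (hψ.fderiv_right (m := 0) (by norm_num)).continuousAt.clm_apply continuousAt_const
  have hmem : (fun i : b => fderiv ℝ ψ y (u i)) ∈ {f : b → F | LinearIndependent ℂ f} := by
    simpa only [Set.mem_ofPred_eq, hu] using hind
  filter_upwards [hcont.eventually_mem (isOpen_setOfPred_linearIndependent.mem_nhds hmem)] with z hz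
  refine eq_top_mono (Submodule.span_mono ?_)
    (LinearIndependent.span_eq_top_of_card_eq_finrank' hz hcard)
  exact Set.range_subset_iff.2 fun i => ⟨u i, rfl⟩

theorem eq_zero_of_comp_eq_zero_of_span_range_eq_top {L : F →L[ℂ] F'} {A : E →L[ℝ] F}
    (hA : Submodule.span ℂ (Set.range A) = ⊤) (hLA : L.restrictScalars ℝ ∘L A = 0) : L = 0 := by
  have hker : Submodule.span ℂ (Set.range A) ≤ L.ker :=
    Submodule.span_le.2 (Set.range_subset_iff.2 fun v => DFunLike.congr_fun hLA v)
  ext v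
  exact hker (hA ▸ Submodule.mem_top)

theorem eventually_iteratedFDeriv_eq_zero_of_totallyReal [FiniteDimensional ℂ F] {ψ : E → F}
    {y : E} {h : F → F'} (hψ : ContDiffAt ℝ 1 ψ y)
    (hspan : Submodule.span ℂ (Set.range (fderiv ℝ ψ y)) = ⊤) (hh : ContDiffAt ℂ ω h (ψ y))
    (hzero : ∀ᶠ z in 𝓝 y, h (ψ z) = 0) (n : ℕ) :
    ∀ᶠ z in 𝓝 y, iteratedFDeriv ℂ n h (ψ z) = 0 := by
  induction n with
  | zero =>
    filter_upwards [hzero] with z hz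
    ext
    simpa using hz
  | succ n ih =>
    filter_upwards [ih.eventually_nhds, eventually_span_range_fderiv_eq_top hψ hspan,
      hψ.eventually (by simp), hψ.continuousAt.eventually (hh.eventually (by simp))]
      with z hzero_z hspan_z hψz hhz
    have hd : DifferentiableAt ℂ (iteratedFDeriv ℂ n h) (ψ z) :=
      hhz.differentiableAt_iteratedFDeriv (WithTop.coe_lt_top _)
    have hcomp : HasFDerivAt (fun z => iteratedFDeriv ℂ n h (ψ z))
        ((fderiv ℂ (iteratedFDeriv ℂ n h) (ψ z)).restrictScalars ℝ ∘L fderiv ℝ ψ z) z :=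
      HasFDerivAt.comp z (hd.hasFDerivAt.restrictScalars ℝ)
        (hψz.differentiableAt one_ne_zero).hasFDerivAt
    have hconst : HasFDerivAt (fun z => iteratedFDeriv ℂ n h (ψ z)) 0 z :=
      (hasFDerivAt_const (𝕜 := ℝ) (0 : F [×n]→L[ℂ] F') z).congr_of_eventuallyEq hzero_z
    rw [iteratedFDeriv_succ_eq_comp_left, Function.comp_apply,
      eq_zero_of_comp_eq_zero_of_span_range_eq_top hspan_z (hcomp.unique hconst), map_zero]

theorem eventually_eq_zero_of_totallyReal [FiniteDimensional ℂ F] [CompleteSpace F'] {ψ : E → F}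
    {y : E} {h : F → F'} (hψ : ContDiffAt ℝ 1 ψ y)
    (hspan : Submodule.span ℂ (Set.range (fderiv ℝ ψ y)) = ⊤) (hh : AnalyticAt ℂ h (ψ y))
    (hzero : ∀ᶠ z in 𝓝 y, h (ψ z) = 0) : ∀ᶠ z in 𝓝 (ψ y), h z = 0 := by
  have hderiv (n : ℕ) : iteratedFDeriv ℂ n h (ψ y) = 0 :=
    (eventually_iteratedFDeriv_eq_zero_of_totallyReal hψ hspan hh.contDiffAt hzero n).self_of_nhds
  obtain ⟨P, r, hP⟩ := hh
  filter_upwards [Metric.eball_mem_nhds (ψ y) hP.r_pos] with z hz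
  have hsum := hP.hasSum_iteratedFDeriv (y := z - ψ y) (by simpa [edist_eq_enorm_sub] using hz)
  simp only [hderiv, zero_apply, smul_zero, add_sub_cancel] at hsum
  exact hsum.unique hasSum_zero

end IdentityTheorem

section ChartExpression

variable {𝕜 : Type*} [RCLike 𝕜] {E : Type*} [NormedAddCommGroup E] [NormedSpace 𝕜 E]
  {M : Type*} [TopologicalSpace M] [ChartedSpace E M]
  {E' : Type*} [NormedAddCommGroup E'] [NormedSpace 𝕜 E']
  {N : Type*} [TopologicalSpace N] [ChartedSpace E' N]
  {g : ∀ x : M, TangentSpace 𝓘(𝕜, E) x →L[𝕜] TangentSpace 𝓘(𝕜, E) x →L[𝕜] 𝕜} {f : N → M}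

theorem eventually_nhds_extChartAt_iff {P : M → Prop} {p x : M}
    (hx : x ∈ (extChartAt 𝓘(𝕜, E) p).source) :
    (∀ᶠ y in 𝓝 (extChartAt 𝓘(𝕜, E) p x), P ((extChartAt 𝓘(𝕜, E) p).symm y)) ↔
      ∀ᶠ x' in 𝓝 x, P x' := by
  have hmap := map_extChartAt_nhds' hx
  rw [modelWithCornersSelf_coe, Set.range_id, nhdsWithin_univ] at hmap
  rw [← hmap, Filter.eventually_map]
  refine Filter.eventually_congr ?_
  filter_upwards [(isOpen_extChartAt_source p).mem_nhds hx] with x' hx'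
  rw [(extChartAt 𝓘(𝕜, E) p).left_inv hx']

theorem inChart_mfderiv_extChartAt [IsManifold 𝓘(𝕜, E) 1 M] {p x : M}
    (hx : x ∈ (extChartAt 𝓘(𝕜, E) p).source) (u v : TangentSpace 𝓘(𝕜, E) x) :
    inChart g p (extChartAt 𝓘(𝕜, E) p x)
        (mfderiv 𝓘(𝕜, E) 𝓘(𝕜, E) (extChartAt 𝓘(𝕜, E) p) x u)
        (mfderiv 𝓘(𝕜, E) 𝓘(𝕜, E) (extChartAt 𝓘(𝕜, E) p) x v) = g x u v := by
  obtain ⟨y, hy, rfl⟩ : ∃ y ∈ (extChartAt 𝓘(𝕜, E) p).target, (extChartAt 𝓘(𝕜, E) p).symm y = x :=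
    ⟨_, (extChartAt 𝓘(𝕜, E) p).map_source hx, (extChartAt 𝓘(𝕜, E) p).left_inv hx⟩
  obtain ⟨u, rfl⟩ := (isInvertible_chartDeriv (E := E) hy).surjective u
  obtain ⟨v, rfl⟩ := (isInvertible_chartDeriv (E := E) hy).surjective v
  rw [(extChartAt 𝓘(𝕜, E) p).right_inv hy]
  exact congrArg₂ (fun a b => inChart g p y a b) (mfderiv_extChartAt_chartDeriv hy u)
    (mfderiv_extChartAt_chartDeriv hy v)

theorem fderiv_writtenInExtChartAt {q : N} (hf : MDifferentiableAt 𝓘(𝕜, E') 𝓘(𝕜, E) f q)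
    (v : E') :
    fderiv 𝕜 (writtenInExtChartAt 𝓘(𝕜, E') 𝓘(𝕜, E) q f) (extChartAt 𝓘(𝕜, E') q q) v =
      mfderiv 𝓘(𝕜, E') 𝓘(𝕜, E) f q v := by
  have h := hf.mfderiv
  rw [modelWithCornersSelf_coe, Set.range_id, fderivWithin_univ] at h
  exact congrArg (fun L => L v) h.symm

theorem contDiffAt_writtenInExtChartAt {n : WithTop ℕ∞} {q : N}
    (hf : ContMDiffAt 𝓘(𝕜, E') 𝓘(𝕜, E) n f q) :
    ContDiffAt 𝕜 n (writtenInExtChartAt 𝓘(𝕜, E') 𝓘(𝕜, E) q f) (extChartAt 𝓘(𝕜, E') q q) := by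
  have h := (contMDiffAt_iff.1 hf).2
  rwa [modelWithCornersSelf_coe, Set.range_id, contDiffWithinAt_univ] at h

theorem eventually_extChartAt_symm_mem_source {q : N} (hf : ContinuousAt f q) :
    ∀ᶠ z in 𝓝 (extChartAt 𝓘(𝕜, E') q q),
      f ((extChartAt 𝓘(𝕜, E') q).symm z) ∈ (extChartAt 𝓘(𝕜, E) (f q)).source :=
  (eventually_nhds_extChartAt_iff (P := fun x => f x ∈ (extChartAt 𝓘(𝕜, E) (f q)).source)
    (mem_extChartAt_source q)).2 (hf.eventually_mem (extChartAt_source_mem_nhds (f q)))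

variable [IsManifold 𝓘(𝕜, E) 1 M] [IsManifold 𝓘(𝕜, E') 1 N]

theorem inChart_fderiv_writtenInExtChartAt {q : N} {z : E'}
    (hz : z ∈ (extChartAt 𝓘(𝕜, E') q).target)
    (hf : MDifferentiableAt 𝓘(𝕜, E') 𝓘(𝕜, E) f ((extChartAt 𝓘(𝕜, E') q).symm z))
    (hfz : f ((extChartAt 𝓘(𝕜, E') q).symm z) ∈ (extChartAt 𝓘(𝕜, E) (f q)).source) (v w : E') :
    inChart g (f q) (writtenInExtChartAt 𝓘(𝕜, E') 𝓘(𝕜, E) q f z)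
        (fderiv 𝕜 (writtenInExtChartAt 𝓘(𝕜, E') 𝓘(𝕜, E) q f) z v)
        (fderiv 𝕜 (writtenInExtChartAt 𝓘(𝕜, E') 𝓘(𝕜, E) q f) z w) =
      g (f ((extChartAt 𝓘(𝕜, E') q).symm z))
        (mfderiv 𝓘(𝕜, E') 𝓘(𝕜, E) f _ (chartDeriv 𝕜 q z v))
        (mfderiv 𝓘(𝕜, E') 𝓘(𝕜, E) f _ (chartDeriv 𝕜 q z w)) := by
  have hsymm : MDifferentiableAt 𝓘(𝕜, E') 𝓘(𝕜, E') (extChartAt 𝓘(𝕜, E') q).symm z :=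
    ((contMDiffOn_extChartAt_symm (n := 1) q).contMDiffAt
      ((isOpen_extChartAt_target q).mem_nhds hz)).mdifferentiableAt one_ne_zero
  have hderiv (v : E') : fderiv 𝕜 (writtenInExtChartAt 𝓘(𝕜, E') 𝓘(𝕜, E) q f) z v =
      mfderiv 𝓘(𝕜, E) 𝓘(𝕜, E) (extChartAt 𝓘(𝕜, E) (f q)) (f ((extChartAt 𝓘(𝕜, E') q).symm z))
        (mfderiv 𝓘(𝕜, E') 𝓘(𝕜, E) f _ (chartDeriv 𝕜 q z v)) :=
    (fderiv_extChartAt_comp (hf.comp z hsymm) hfz v).trans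
      (congrArg _ (congrArg (fun L => L v) (mfderiv_comp z hf hsymm)))
  rw [hderiv v, hderiv w]
  exact inChart_mfderiv_extChartAt hfz _ _

end ChartExpression

section IsotropyLocus

variable {𝕜 : Type*} [RCLike 𝕜] {E : Type*} [NormedAddCommGroup E] [NormedSpace 𝕜 E]
  {M : Type*} [TopologicalSpace M] [ChartedSpace E M]
  {g : ∀ x : M, TangentSpace 𝓘(𝕜, E) x →L[𝕜] TangentSpace 𝓘(𝕜, E) x →L[𝕜] 𝕜}
  {D : ∀ x : M, Submodule 𝕜 (TangentSpace 𝓘(𝕜, E) x)} {m : ℕ}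

/-- The subspace `D x` of the tangent space at `x` is isotropic for `g`. -/
def IsIsotropicAt (g : ∀ x : M, TangentSpace 𝓘(𝕜, E) x →L[𝕜] TangentSpace 𝓘(𝕜, E) x →L[𝕜] 𝕜)
    (D : ∀ x : M, Submodule 𝕜 (TangentSpace 𝓘(𝕜, E) x)) (x : M) : Prop :=
  ∀ u ∈ D x, ∀ v ∈ D x, g x u v = 0

theorem isIsotropicAt_iff_of_eq_span {I : Type*} {x : M} {V : I → TangentSpace 𝓘(𝕜, E) x}
    (hD : D x = Submodule.span 𝕜 (Set.range V)) :
    IsIsotropicAt g D x ↔ ∀ i j, g x (V i) (V j) = 0 := by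
  have hV (i : I) : V i ∈ D x := hD ▸ Submodule.subset_span ⟨i, rfl⟩
  refine ⟨fun h i j => h _ (hV i) _ (hV j), fun h u hu v hv => ?_⟩
  have hright (i : I) : D x ≤ (g x (V i)).ker :=
    hD.trans_le (Submodule.span_le.2 (Set.range_subset_iff.2 (h i)))
  have hleft : D x ≤ (ContinuousLinearMap.flip (E := E) (F := E) (g x) v).ker :=
    hD.trans_le (Submodule.span_le.2 (Set.range_subset_iff.2 fun i => hright i hv))
  exact hleft hu

theorem exists_contDiffOn_isIsotropicAt_iff {n : WithTop ℕ∞} [CompleteSpace E]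
    [IsManifold 𝓘(𝕜, E) 1 M] [IsManifold 𝓘(𝕜, E) (n + 1) M] (hg : IsMetric n g)
    (hD : IsDistribution n m D) (p : M) :
    ∃ (S : Set E) (h : E → Fin m → Fin m → 𝕜), IsOpen S ∧ extChartAt 𝓘(𝕜, E) p p ∈ S ∧
      ContDiffOn 𝕜 n h S ∧
      ∀ y ∈ S, IsIsotropicAt g D ((extChartAt 𝓘(𝕜, E) p).symm y) ↔ h y = 0 := by
  obtain ⟨U, V, hU, hp, hV, hspan⟩ := hD p
  refine ⟨_, fun y i j => inChart g p y (chartField p (V i) y) (chartField p (V j) y),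
    isOpen_chart_preimage p hU, ⟨mem_extChartAt_target p, ?_⟩, ?_, fun y hy => ?_⟩
  · rwa [Set.mem_preimage, extChartAt_to_inv]
  · have hfield (i : Fin m) := contDiffOn_chartField p hU (hV i)
    exact contDiffOn_pi.2 fun i => contDiffOn_pi.2 fun j =>
      (((hg.contDiffOn p).mono Set.inter_subset_left).clm_apply (hfield i)).clm_apply (hfield j)
  · rw [isIsotropicAt_iff_of_eq_span (hspan _ hy.2).2]
    simp only [funext_iff, inChart_chartField hy.1, Pi.zero_apply]

theorem isClopen_setOf_eventually_isIsotropicAt [CompleteSpace E]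
    [IsManifold 𝓘(𝕜, E) ω M] (hg : IsMetric ω g) (hD : IsDistribution ω m D) :
    IsClopen {x : M | ∀ᶠ x' in 𝓝 x, IsIsotropicAt g D x'} := by
  have : IsManifold 𝓘(𝕜, E) (ω + 1) M := ‹IsManifold 𝓘(𝕜, E) ω M›
  let _ : NormedSpace ℝ E := NormedSpace.restrictScalars ℝ 𝕜 E
  refine ⟨isClosed_of_closure_subset fun p hp => ?_, isOpen_setOfPred_eventually_nhds⟩
  obtain ⟨S, h, hS, hpS, hh, hiff⟩ := exists_contDiffOn_isIsotropicAt_iff hg hD p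
  obtain ⟨r, hr, hball⟩ := Metric.isOpen_iff.1 hS _ hpS
  obtain ⟨x, ⟨hx, hxr⟩, hx_iso⟩ := mem_closure_iff_nhds.1 hp _ (Filter.inter_mem
    (extChartAt_source_mem_nhds (I := 𝓘(𝕜, E)) p)
    ((continuousAt_extChartAt (I := 𝓘(𝕜, E)) p).preimage_mem_nhds (Metric.ball_mem_nhds _ hr)))
  have hx_zero : ∀ᶠ y in 𝓝 (extChartAt 𝓘(𝕜, E) p x), h y = 0 := by
    filter_upwards [(eventually_nhds_extChartAt_iff hx).2 hx_iso,
      Metric.isOpen_ball.mem_nhds hxr] with y hy hyr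
    exact (hiff y (hball hyr)).1 hy
  have hzero : Set.EqOn h 0 (Metric.ball (extChartAt 𝓘(𝕜, E) p p) r) :=
    AnalyticOnNhd.eqOn_zero_of_preconnected_of_eventuallyEq_zero
      (fun y hy => (hh.contDiffAt (hS.mem_nhds (hball hy))).analyticAt)
      (convex_ball _ _).isPreconnected hxr hx_zero
  refine (eventually_nhds_extChartAt_iff (mem_extChartAt_source (I := 𝓘(𝕜, E)) p)).1 ?_
  filter_upwards [Metric.ball_mem_nhds _ hr] with y hy
  exact (hiff y (hball hy)).2 (hzero hy)

end IsotropyLocus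

section Complexification

variable {E : Type*} [NormedAddCommGroup E] [NormedSpace ℝ E]
  {M : Type*} [TopologicalSpace M] [ChartedSpace E M]
  {F : Type*} [NormedAddCommGroup F] [NormedSpace ℂ F]
  {X : Type*} [TopologicalSpace X] [ChartedSpace F X]
  {g : ∀ x : M, TangentSpace 𝓘(ℝ, E) x →L[ℝ] TangentSpace 𝓘(ℝ, E) x →L[ℝ] ℝ}
  {D : ∀ x : M, Submodule ℂ (ℂ ⊗[ℝ] TangentSpace 𝓘(ℝ, E) x)}
  {ι : M → X} {m : ℕ}
  {gc : (x : X) → TangentSpace 𝓘(ℂ, F) x →L[ℂ] TangentSpace 𝓘(ℂ, F) x →L[ℂ] ℂ}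
  {Dc : (x : X) → Submodule ℂ (TangentSpace 𝓘(ℂ, F) x)}

theorem apply_complexDifferential_of_extendsMetric (hext : ExtendsMetric ι g gc) (p : M)
    (z w : ℂ ⊗[ℝ] TangentSpace 𝓘(ℝ, E) p) :
    gc (ι p) (complexDifferential ι p z) (complexDifferential ι p w) =
      (bilin g p).baseChange ℂ z w := by
  have hI (v : TangentSpace 𝓘(ℝ, E) p) :
      (Complex.I ⊗ₜ[ℝ] v : ℂ ⊗[ℝ] TangentSpace 𝓘(ℝ, E) p) = Complex.I • ((1 : ℂ) ⊗ₜ[ℝ] v) := by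
    rw [TensorProduct.smul_tmul', smul_eq_mul, mul_one]
  rw [← complexVector_rePart_imPart z, ← complexVector_rePart_imPart w, baseChange_complexVector]
  simp only [complexVector, hI, map_add, map_smul, add_apply, smul_apply, hext p]
  simp only [Complex.ext_iff, bilin]
  constructor <;> simp <;> ring

theorem isIsotropicAt_of_extends (hiso : ∀ x, IsIsotropic (bilin g x) (D x))
    (hext : ExtendsMetric ι g gc) (hextD : ExtendsDistribution ι D Dc) (p : M) :
    IsIsotropicAt gc Dc (ι p) := by
  intro u hu v hv
  rw [hextD p] at hu hv
  obtain ⟨z, hz, rfl⟩ := hu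
  obtain ⟨w, hw, rfl⟩ := hv
  exact (apply_complexDifferential_of_extendsMetric hext p z w).trans (hiso p z hz w hw)

theorem finrank_of_isComplexification [FiniteDimensional ℝ E]
    (hι : IsComplexification (E := E) (F := F) ι) (p : M) :
    Module.finrank ℂ F = Module.finrank ℝ E :=
  (LinearEquiv.ofBijective _ (hι.bijective p)).finrank_eq.symm.trans Module.finrank_baseChange

theorem span_range_fderiv_writtenInExtChartAt_eq_top
    (hι : IsComplexification (E := E) (F := F) ι) (p : M) :
    Submodule.span ℂ (Set.range (fderiv ℝ (writtenInExtChartAt 𝓘(ℝ, E) 𝓘(ℝ, F) p ι)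
      (extChartAt 𝓘(ℝ, E) p p))) = ⊤ := by
  refine Submodule.eq_top_iff'.2 fun z => ?_
  obtain ⟨w, rfl⟩ := (hι.bijective p).2 z
  induction w using TensorProduct.induction_on with
  | zero => exact (map_zero (complexDifferential (E := E) (F := F) ι p)).symm ▸ Submodule.zero_mem _
  | tmul c v =>
    exact Submodule.smul_mem _ c (Submodule.subset_span
      ⟨v, fderiv_writtenInExtChartAt ((hι.analytic p).mdifferentiableAt (by simp)) v⟩)
  | add a b ha hb =>
    exact (map_add (complexDifferential (E := E) (F := F) ι p) a b).symm ▸ Submodule.add_mem _ ha hb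

variable [FiniteDimensional ℂ F] [IsManifold 𝓘(ℂ, F) ω X]

theorem eventually_isIsotropicAt_of_isComplexification
    (hiso : ∀ x, IsIsotropic (bilin g x) (D x))
    (hι : IsComplexification (E := E) (F := F) ι) (hgc : IsMetric ω gc)
    (hext : ExtendsMetric ι g gc) (hDc : IsDistribution ω m Dc)
    (hextD : ExtendsDistribution ι D Dc) (p : M) :
    ∀ᶠ x in 𝓝 (ι p), IsIsotropicAt gc Dc x := by
  have : IsManifold 𝓘(ℂ, F) (ω + 1) X := ‹IsManifold 𝓘(ℂ, F) ω X›
  have : CompleteSpace F := FiniteDimensional.complete ℂ F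
  obtain ⟨S, h, hS, hpS, hh, hiff⟩ := exists_contDiffOn_isIsotropicAt_iff hgc hDc (ι p)
  set ψ := writtenInExtChartAt 𝓘(ℝ, E) 𝓘(ℝ, F) p ι
  have hψ_apply : ψ (extChartAt 𝓘(ℝ, E) p p) = extChartAt 𝓘(ℂ, F) (ι p) (ι p) :=
    congrArg (fun q => extChartAt 𝓘(ℂ, F) (ι p) (ι q)) (extChartAt_to_inv p)
  have hψ : ContDiffAt ℝ 1 ψ (extChartAt 𝓘(ℝ, E) p p) :=
    (contDiffAt_writtenInExtChartAt (hι.analytic p)).of_le le_top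
  have hzero : ∀ᶠ y in 𝓝 (extChartAt 𝓘(ℝ, E) p p), h (ψ y) = 0 := by
    filter_upwards [eventually_extChartAt_symm_mem_source (𝕜 := ℝ) (E := F)
        hι.isEmbedding.continuous.continuousAt,
      hψ.continuousAt.eventually_mem (hψ_apply ▸ hS.mem_nhds hpS)] with y hy_source hyS
    have hinv : (extChartAt 𝓘(ℂ, F) (ι p)).symm (ψ y) = ι ((extChartAt 𝓘(ℝ, E) p).symm y) :=
      (extChartAt 𝓘(ℂ, F) (ι p)).left_inv hy_source
    exact (hiff _ hyS).1 (hinv ▸ isIsotropicAt_of_extends hiso hext hextD _)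
  have hzero' : ∀ᶠ z in 𝓝 (extChartAt 𝓘(ℂ, F) (ι p) (ι p)), h z = 0 :=
    hψ_apply ▸ eventually_eq_zero_of_totallyReal hψ
      (span_range_fderiv_writtenInExtChartAt_eq_top hι p)
      (hψ_apply ▸ (hh.contDiffAt (hS.mem_nhds hpS)).analyticAt) hzero
  refine (eventually_nhds_extChartAt_iff (mem_extChartAt_source (I := 𝓘(ℂ, F)) (ι p))).1 ?_
  filter_upwards [hzero', hS.mem_nhds hpS] with z hz hzS
  exact (hiff z hzS).2 hz

theorem isIsotropicAt_of_isComplexification (hiso : ∀ x, IsIsotropic (bilin g x) (D x))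
    (hι : IsComplexification (E := E) (F := F) ι) (hgc : IsMetric ω gc)
    (hext : ExtendsMetric ι g gc) (hDc : IsDistribution ω m Dc)
    (hextD : ExtendsDistribution ι D Dc) (x : X) : IsIsotropicAt gc Dc x := by
  have : CompleteSpace F := FiniteDimensional.complete ℂ F
  obtain ⟨p, hp⟩ := hι.meets x
  have hsub := (isClopen_setOf_eventually_isIsotropicAt hgc hDc).connectedComponent_subset
    (eventually_isIsotropicAt_of_isComplexification hiso hι hgc hext hDc hextD p)
  exact (hsub (connectedComponent_eq hp ▸ mem_connectedComponent)).self_of_nhds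

end Complexification

section TotallyGeodesic

variable {𝕜 : Type*} [RCLike 𝕜] {E : Type*} [NormedAddCommGroup E] [NormedSpace 𝕜 E]
  {M : Type*} [TopologicalSpace M] [ChartedSpace E M]
  {E' : Type*} [NormedAddCommGroup E'] [NormedSpace 𝕜 E']
  {N : Type*} [TopologicalSpace N] [ChartedSpace E' N]
  {g : ∀ x : M, TangentSpace 𝓘(𝕜, E) x →L[𝕜] TangentSpace 𝓘(𝕜, E) x →L[𝕜] 𝕜} {f : N → M}

theorem IsMetric.of_le {n n' : WithTop ℕ∞} (hg : IsMetric n g) (h : n' ≤ n) : IsMetric n' g :=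
  ⟨hg.symm, hg.nondegenerate, fun p => (hg.contDiffOn p).of_le h⟩

theorem finrank_of_isIntegralManifold [IsManifold 𝓘(𝕜, E) 1 M] {n : WithTop ℕ∞} {m : ℕ}
    {D : ∀ x : M, Submodule 𝕜 (TangentSpace 𝓘(𝕜, E) x)} (hD : IsDistribution n m D)
    (hf : IsIntegralManifold (E' := E') D f) (q : N) : Module.finrank 𝕜 E' = m := by
  obtain ⟨U, V, -, hq, -, hspan⟩ := hD (f q)
  obtain ⟨hind, hDV⟩ := hspan _ hq
  have hrank := finrank_span_eq_card hind
  rw [Fintype.card_fin, ← hDV, ← hf.range_eq q] at hrank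
  exact (LinearMap.finrank_range_of_inj
    (f := (mfderiv 𝓘(𝕜, E') 𝓘(𝕜, E) f q).toLinearMap) (hf.injective q)).symm.trans hrank

variable [IsManifold 𝓘(𝕜, E) 1 M] [IsManifold 𝓘(𝕜, E') 1 N] [FiniteDimensional 𝕜 E]
  [FiniteDimensional 𝕜 E']

theorem exists_lift_chart_of_geodesic (hdim : Module.finrank 𝕜 E = 2 * Module.finrank 𝕜 E')
    (hg : IsMetric 2 g) (hf : ContMDiff 𝓘(𝕜, E') 𝓘(𝕜, E) 2 f) {q : N}
    (hinj : Function.Injective (mfderiv 𝓘(𝕜, E') 𝓘(𝕜, E) f q))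
    (hiso : ∀ q u v,
      g (f q) (mfderiv 𝓘(𝕜, E') 𝓘(𝕜, E) f q u) (mfderiv 𝓘(𝕜, E') 𝓘(𝕜, E) f q v) = 0)
    {x : 𝕜 → E} {u : E'} (hx : ContDiffAt 𝕜 2 x 0) (hx0 : x 0 = extChartAt 𝓘(𝕜, E) (f q) (f q))
    (hx1 : deriv x 0 = mfderiv 𝓘(𝕜, E') 𝓘(𝕜, E) f q u)
    (hgeo : ∀ᶠ t in 𝓝 0,
      accelerationForm (inChart g (f q)) (x t) (deriv x t) (deriv (deriv x) t) = 0) :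
    ∃ c : 𝕜 → E', ContDiffAt 𝕜 2 c 0 ∧ c 0 = extChartAt 𝓘(𝕜, E') q q ∧
      ∀ᶠ t in 𝓝 0, writtenInExtChartAt 𝓘(𝕜, E') 𝓘(𝕜, E) q f (c t) = x t := by
  have hψd := fderiv_writtenInExtChartAt (hf.mdifferentiable two_ne_zero q)
  have hψ_apply : writtenInExtChartAt 𝓘(𝕜, E') 𝓘(𝕜, E) q f (extChartAt 𝓘(𝕜, E') q q) =
      extChartAt 𝓘(𝕜, E) (f q) (f q) :=
    congrArg (fun p => extChartAt 𝓘(𝕜, E) (f q) (f p)) (extChartAt_to_inv q)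
  have hiso_chart : ∀ᶠ z in 𝓝 (extChartAt 𝓘(𝕜, E') q q), ∀ v w : E',
      inChart g (f q) (writtenInExtChartAt 𝓘(𝕜, E') 𝓘(𝕜, E) q f z)
        (fderiv 𝕜 (writtenInExtChartAt 𝓘(𝕜, E') 𝓘(𝕜, E) q f) z v)
        (fderiv 𝕜 (writtenInExtChartAt 𝓘(𝕜, E') 𝓘(𝕜, E) q f) z w) = 0 := by
    filter_upwards [extChartAt_target_mem_nhds (I := 𝓘(𝕜, E')) q,
      eventually_extChartAt_symm_mem_source (E := E) (E' := E')
        hf.continuous.continuousAt]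
      with z hz hfz v w
    rw [inChart_fderiv_writtenInExtChartAt hz (hf.mdifferentiable two_ne_zero _) hfz, hiso]
  refine exists_lift_of_geodesic hdim (contDiffAt_writtenInExtChartAt (hf q))
    (fun v w h => hinj ((hψd v).symm.trans (h.trans (hψd w)))) ?_ (inChart_symm hg (f q)) ?_
    hiso_chart hx (hx0.trans hψ_apply.symm) (hx1.trans (hψd u).symm) hgeo <;> rw [hψ_apply]
  · exact (hg.contDiffOn (f q)).contDiffAt (extChartAt_target_mem_nhds (f q))
  · exact fun v => nondegenerate_inChart hg (mem_extChartAt_target (f q))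

omit [IsManifold 𝓘(𝕜, E') 1 N] in
theorem isTotallyGeodesic_of_isotropic [IsManifold 𝓘(𝕜, E') 2 N]
    (hdim : Module.finrank 𝕜 E = 2 * Module.finrank 𝕜 E')
    (hg : IsMetric 2 g) (hf : ContMDiff 𝓘(𝕜, E') 𝓘(𝕜, E) 2 f)
    (hinj : ∀ q, Function.Injective (mfderiv 𝓘(𝕜, E') 𝓘(𝕜, E) f q))
    (hiso : ∀ q u v,
      g (f q) (mfderiv 𝓘(𝕜, E') 𝓘(𝕜, E) f q u) (mfderiv 𝓘(𝕜, E') 𝓘(𝕜, E) f q v) = 0) :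
    IsTotallyGeodesic (E' := E') g f := by
  rintro γ q u ⟨hγ, hgeo⟩ htangent
  have hγ0 : γ 0 = f q := congrArg Bundle.TotalSpace.proj htangent
  have hγ1 : (mfderiv 𝓘(𝕜, 𝕜) 𝓘(𝕜, E) γ 0 (1 : 𝕜) : E) = mfderiv 𝓘(𝕜, E') 𝓘(𝕜, E) f q u :=
    congrArg (fun z : TangentBundle 𝓘(𝕜, E) M => (z.2 : E)) htangent
  have hx : ContDiffAt 𝕜 2 (fun t => extChartAt 𝓘(𝕜, E) (γ 0) (γ t)) 0 :=
    contDiffAt_writtenInExtChartAt hγ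
  have hx1 : deriv (fun t => extChartAt 𝓘(𝕜, E) (γ 0) (γ t)) 0 =
      mfderiv 𝓘(𝕜, 𝕜) 𝓘(𝕜, E) γ 0 (1 : 𝕜) :=
    fderiv_apply_one_eq_deriv.symm.trans
      (fderiv_writtenInExtChartAt (hγ.mdifferentiableAt two_ne_zero) (1 : 𝕜))
  rw [hγ0] at hgeo hx hx1
  obtain ⟨c, hc, hc0, hcx⟩ := exists_lift_chart_of_geodesic hdim hg hf (hinj q) hiso hx
    (congrArg _ hγ0) (hx1.trans hγ1)
    (hgeo.mono fun t ht => ContinuousLinearMap.ext fun w =>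
      (accelerationForm_apply ..).trans (ht w))
  have hc0_symm : (extChartAt 𝓘(𝕜, E') q).symm (c 0) = q := by rw [hc0, extChartAt_to_inv]
  have hc_lift : ContMDiffAt 𝓘(𝕜, 𝕜) 𝓘(𝕜, E') 2 (fun t => (extChartAt 𝓘(𝕜, E') q).symm (c t)) 0 :=
    ((contMDiffOn_extChartAt_symm q).contMDiffAt
      (hc0 ▸ extChartAt_target_mem_nhds q)).comp 0 hc.contMDiffAt
  have hfc : ContinuousAt (fun t => f ((extChartAt 𝓘(𝕜, E') q).symm (c t))) 0 :=
    hf.continuous.continuousAt.comp hc_lift.continuousAt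
  have hsource := extChartAt_source_mem_nhds (I := 𝓘(𝕜, E)) (f q)
  refine ⟨_, hc0_symm, hc_lift, ?_⟩
  filter_upwards [hcx, hγ.continuousAt.eventually_mem (by rwa [hγ0]),
    hfc.eventually_mem (by rwa [hc0_symm])] with t ht hγt hfct
  exact (extChartAt 𝓘(𝕜, E) (f q)).injOn hfct hγt ht

end TotallyGeodesic

end IsotropicFoliation

end

open IsotropicFoliation in
theorem mainTheorem10_general
    {E : Type*} [NormedAddCommGroup E] [NormedSpace ℝ E] [FiniteDimensional ℝ E]
    {M : Type*} [TopologicalSpace M] [ChartedSpace E M] [IsManifold 𝓘(ℝ, E) ∞ M]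
    (m : ℕ) (hm : Module.finrank ℝ E = 2 * m)
    (g : ∀ x : M, TangentSpace 𝓘(ℝ, E) x →L[ℝ] TangentSpace 𝓘(ℝ, E) x →L[ℝ] ℝ)
    (D : ∀ x : M, Submodule ℂ (ℂ ⊗[ℝ] TangentSpace 𝓘(ℝ, E) x))
    (hiso : ∀ x, IsIsotropic (bilin g x) (D x)) :
    (∀ {F : Type*} [NormedAddCommGroup F] [NormedSpace ℂ F] [FiniteDimensional ℂ F]
        {X : Type*} [TopologicalSpace X] [ChartedSpace F X] [IsManifold 𝓘(ℂ, F) ω X]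
        (ι : M → X), IsComplexification (E := E) (F := F) ι →
      ∀ gc : (x : X) → TangentSpace 𝓘(ℂ, F) x →L[ℂ] TangentSpace 𝓘(ℂ, F) x →L[ℂ] ℂ,
        IsMetric ω gc → ExtendsMetric ι g gc →
      ∀ Dc : (x : X) → Submodule ℂ (TangentSpace 𝓘(ℂ, F) x),
        IsDistribution ω m Dc → ExtendsDistribution ι D Dc →
      ∀ {F' : Type*} [NormedAddCommGroup F'] [NormedSpace ℂ F'] [FiniteDimensional ℂ F']
        {N : Type*} [TopologicalSpace N] [ChartedSpace F' N] [IsManifold 𝓘(ℂ, F') ω N]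
        (f : N → X), IsIntegralManifold (E' := F') Dc f → IsTotallyGeodesic (E' := F') gc f) ∧
    (IsMetric ∞ g → IsComplexDistribution ∞ m D →
      (∀ x, Module.finrank ℂ ↥(D x ⊓ conjugate (D x)) = 1) →
      (∀ p : M, ∃ (U : Set M) (k : ∀ x : M, TangentSpace 𝓘(ℝ, E) x), IsOpen U ∧ p ∈ U ∧
        ContMDiffOn 𝓘(ℝ, E) 𝓘(ℝ, E).tangent ∞
          (fun x => (⟨x, k x⟩ : TangentBundle 𝓘(ℝ, E) M)) U ∧
        ∀ x ∈ U, k x ≠ 0 ∧ g x (k x) (k x) = 0 ∧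
          D x ⊓ conjugate (D x) = Submodule.span ℂ {(1 : ℂ) ⊗ₜ[ℝ] k x}) ∧
      (IsIntegrable D → ∀ (γ : ℝ → M) (t₀ : ℝ), ContMDiffAt 𝓘(ℝ, ℝ) 𝓘(ℝ, E) 2 γ t₀ →
        mfderiv 𝓘(ℝ, ℝ) 𝓘(ℝ, E) γ t₀ ≠ 0 →
        (∀ᶠ t in 𝓝 t₀, (1 : ℂ) ⊗ₜ[ℝ] mfderiv 𝓘(ℝ, ℝ) 𝓘(ℝ, E) γ t (1 : ℝ) ∈
          D (γ t) ⊓ conjugate (D (γ t))) →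
        IsUnparametrizedGeodesicAt g γ t₀)) := by
  refine ⟨fun {F} _ _ _ {X} _ _ _ ι hι gc hgc hext Dc hDc hextD {F'} _ _ _ {N} _ _ _ f hf => ?_,
    fun hg hD hline => ⟨exists_null_section hm hg hD hiso hline, fun hint _ _ hγ hγ0 hγD =>
      isUnparametrizedGeodesicAt_of_mem hm hg hD hiso hint hline hγ hγ0 hγD⟩⟩
  have hDc_iso := isIsotropicAt_of_isComplexification hiso hι hgc hext hDc hextD
  have hf_mem (q : N) (u : TangentSpace 𝓘(ℂ, F') q) : mfderiv 𝓘(ℂ, F') 𝓘(ℂ, F) f q u ∈ Dc (f q) :=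
    hf.range_eq q ▸ ⟨u, rfl⟩
  have hdim (q : N) : Module.finrank ℂ F = 2 * Module.finrank ℂ F' := by
    obtain ⟨p, -⟩ := hι.meets (f q)
    rw [finrank_of_isIntegralManifold hDc hf q, finrank_of_isComplexification hι p, hm]
  exact fun γ q => isTotallyGeodesic_of_isotropic (hdim q) (hgc.of_le le_top)
    (hf.contMDiff.of_le le_top) hf.injective
    (fun q u v => hDc_iso (f q) _ (hf_mem q u) _ (hf_mem q v)) γ q

theorem mainTheorem10
    {E : Type*} [NormedAddCommGroup E] [NormedSpace ℝ E] [FiniteDimensional ℝ E]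
    {M : Type*} [TopologicalSpace M] [ChartedSpace E M] [IsManifold 𝓘(ℝ, E) ∞ M]
    (m : ℕ) (hm : Module.finrank ℝ E = 2 * m)
    (g : ∀ x : M, TangentSpace 𝓘(ℝ, E) x →L[ℝ] TangentSpace 𝓘(ℝ, E) x →L[ℝ] ℝ)
    (hg : IsotropicFoliation.IsMetric ∞ g)
    (D : ∀ x : M, Submodule ℂ (ℂ ⊗[ℝ] TangentSpace 𝓘(ℝ, E) x))
    (hD : IsotropicFoliation.IsComplexDistribution ∞ m D)
    (hiso : ∀ x, IsotropicFoliation.IsIsotropic (IsotropicFoliation.bilin g x) (D x))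
    (hint : IsotropicFoliation.IsIntegrable D) :
    -- analytic case: integral surfaces in a complexification are totally geodesic
    (IsManifold 𝓘(ℝ, E) ω M → IsotropicFoliation.IsMetric ω g →
      IsotropicFoliation.IsComplexDistribution ω m D →
      ∀ {F : Type*} [NormedAddCommGroup F] [NormedSpace ℂ F] [FiniteDimensional ℂ F]
        {X : Type*} [TopologicalSpace X] [ChartedSpace F X] [IsManifold 𝓘(ℂ, F) ω X]
        (ι : M → X), IsotropicFoliation.IsComplexification (E := E) (F := F) ι →
      ∀ gc : (x : X) → TangentSpace 𝓘(ℂ, F) x →L[ℂ] TangentSpace 𝓘(ℂ, F) x →L[ℂ] ℂ,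
        IsotropicFoliation.IsMetric ω gc → IsotropicFoliation.ExtendsMetric ι g gc →
      ∀ Dc : (x : X) → Submodule ℂ (TangentSpace 𝓘(ℂ, F) x),
        IsotropicFoliation.IsDistribution ω m Dc →
        IsotropicFoliation.ExtendsDistribution ι D Dc →
      ∀ {F' : Type*} [NormedAddCommGroup F'] [NormedSpace ℂ F'] [FiniteDimensional ℂ F']
        {N : Type*} [TopologicalSpace N] [ChartedSpace F' N] [IsManifold 𝓘(ℂ, F') ω N]
        (f : N → X), IsotropicFoliation.IsIntegralManifold (E' := F') Dc f →
        IsotropicFoliation.IsTotallyGeodesic (E' := F') gc f) ∧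
    -- Lorentzian case: the intersection of `D` with its conjugate is a geodesic null congruence
    ((∀ x, IsotropicFoliation.IsLorentzian (IsotropicFoliation.bilin g x)) →
      (∀ p : M, ∃ (U : Set M) (k : ∀ x : M, TangentSpace 𝓘(ℝ, E) x), IsOpen U ∧ p ∈ U ∧
        ContMDiffOn 𝓘(ℝ, E) 𝓘(ℝ, E).tangent ∞
          (fun x => (⟨x, k x⟩ : TangentBundle 𝓘(ℝ, E) M)) U ∧
        ∀ x ∈ U, k x ≠ 0 ∧ g x (k x) (k x) = 0 ∧
          D x ⊓ IsotropicFoliation.conjugate (D x) = Submodule.span ℂ {(1 : ℂ) ⊗ₜ[ℝ] k x}) ∧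
      ∀ (γ : ℝ → M) (t₀ : ℝ), ContMDiffAt 𝓘(ℝ, ℝ) 𝓘(ℝ, E) 2 γ t₀ →
        mfderiv 𝓘(ℝ, ℝ) 𝓘(ℝ, E) γ t₀ ≠ 0 →
        (∀ᶠ t in 𝓝 t₀, (1 : ℂ) ⊗ₜ[ℝ] mfderiv 𝓘(ℝ, ℝ) 𝓘(ℝ, E) γ t (1 : ℝ) ∈
          D (γ t) ⊓ IsotropicFoliation.conjugate (D (γ t))) →
        IsotropicFoliation.IsUnparametrizedGeodesicAt g γ t₀) := by
  obtain ⟨hanalytic, hline⟩ := mainTheorem10_general m hm g D hiso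
  refine ⟨fun _ _ _ => hanalytic, fun hL => (hline hg hD fun x => ?_).imp_right fun h => h hint⟩
  exact IsotropicFoliation.finrank_inf_conjugate_eq_one_of_isLorentzian (hg.symm x) (hL x) (hiso x)
    (hm.trans (congrArg _ (IsotropicFoliation.finrank_of_isComplexDistribution hD x).symm))
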